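/- Let $X_1,X_2,\ldots$ be independent random variables, uniformly distributed on $[0,1]$, and let $\mathcal F_i=\sigma\{X_1,\ldots,X_i\}$. For $n\ge 1$ let $\Pi(n)$ be the set of all sequences $\pi=(\tau_1,\ldots,\tau_n)$ of stopping times with respect to $(\mathcal F_i)$ such that, almost surely, $1\le\tau_1<\tau_2<\cdots<\tau_n$ and $X_{\tau_1}<X_{\tau_2}<\cdots<X_{\tau_n}$, and such that $\mathbb E[\tau_n]<\infty$. Put $\beta(n)=\inf_{\pi\in\Pi(n)}\mathbb E[\tau_n]$. A threshold policy of size $n$ is a $\pi=(\tau_1,\ldots,\tau_n)\in\Pi(n)$ that is given, for some parameters $t_1,\ldots,t_n\in[0,1]$, by the recursion $$\tau_{k+1}=\min\bigl\{i>\tau_k:\ X_i\in[X_{\tau_k},\,X_{\tau_k}+t_{n-k}(1-X_{\tau_k})]\bigr\},\qquad 0\le k<n,$$ which starts from $\tau_0=0$ and $X_0=0$. Theorem 2. For every $n\ge 1$ the infimum $\beta(n)$ is attained on $\Pi(n)$, and there is a unique threshold policy $\pi^*=(\tau_1^*,\ldots,\tau_n^*)\in\Pi(n)$, with uniquely determined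 parameters $t_1,\ldots,t_n\in[0,1]$, for which $$\beta(n)=\min_{\pi\in\Pi(n)}\mathbb E[\tau_n]=\mathbb E[\tau_n^*].$$ For this optimal policy $\tau_n^*$ has finite variance, and for every $\alpha>2$ $$\mathrm{Var}[\tau_n^*]=\tfrac13 n^3+O(n^2\log^\alpha n)\qquad\text{as } n\to\infty.$$ -/

import Mathlib

open MeasureTheory ProbabilityTheory Filter Asymptotics Set
open scoped ENNReal

namespace MonotoneSelection

noncomputable section

/-- `X 1, X 2, …` are independent random variables, uniformly distributed on `[0, 1]`. The entry
`X 0` is not an observation: it is the conventional starting value `0`. -/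
structure IsUniformSequence {Ω : Type*} [MeasurableSpace Ω] (X : ℕ → Ω → ℝ) (μ : Measure Ω) :
    Prop where
  zero : ∀ ω, X 0 ω = 0
  measurable : ∀ i, Measurable (X i)
  indep : iIndepFun (fun i : ℕ => X (i + 1)) μ
  uniform : ∀ i, pdf.IsUniform (X (i + 1)) (Icc (0 : ℝ) 1) μ volume

/-- The filtration `ℱ i = σ(X 1, …, X i)`; the constant `X 0` contributes nothing to it. -/
def IsUniformSequence.filtration {Ω : Type*} [mΩ : MeasurableSpace Ω] {X : ℕ → Ω → ℝ}
    {μ : Measure Ω} (hX : IsUniformSequence X μ) : Filtration ℕ mΩ :=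
  Filtration.natural X fun i => (hX.measurable i).stronglyMeasurable

/-- The completion time `τ n` of a sequence of times `τ 0, τ 1, …, τ n`. -/
def completionTime {Ω : Type*} {n : ℕ} (τ : Fin (n + 1) → Ω → ℕ∞) : Ω → ℕ∞ :=
  τ (Fin.last n)

/-- The expected completion time, as an extended nonnegative real. -/
def expectedTime {Ω : Type*} [MeasurableSpace Ω] (μ : Measure Ω) {n : ℕ}
    (τ : Fin (n + 1) → Ω → ℕ∞) : ℝ≥0∞ :=
  ∫⁻ ω, (completionTime τ ω : ℝ≥0∞) ∂μ

/-- The class `Π(n)` of selection policies of size `n` with finite expected completion time: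
stopping times `τ 1, …, τ n` (preceded by the convention `τ 0 = 0`) such that almost surely
`1 ≤ τ 1 < ⋯ < τ n` and `X (τ 1) < ⋯ < X (τ n)`. -/
structure IsPolicy {Ω : Type*} [MeasurableSpace Ω] {X : ℕ → Ω → ℝ} {μ : Measure Ω}
    (hX : IsUniformSequence X μ) (n : ℕ) (τ : Fin (n + 1) → Ω → ℕ∞) : Prop where
  start : ∀ ω, τ 0 ω = 0
  stopping : ∀ k, IsStoppingTime hX.filtration (τ k)
  times_lt : ∀ᵐ ω ∂μ, StrictMono fun k => τ k ω
  values_lt : ∀ᵐ ω ∂μ, ∀ j k : Fin (n + 1), 0 < j → j < k →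
    stoppedValue X (τ j) ω < stoppedValue X (τ k) ω
  finite : expectedTime μ τ < ∞

/-- `β(n)`, the infimum of the expected completion times over `Π(n)`. -/
def beta {Ω : Type*} [MeasurableSpace Ω] {X : ℕ → Ω → ℝ} {μ : Measure Ω}
    (hX : IsUniformSequence X μ) (n : ℕ) : ℝ≥0∞ :=
  sInf (expectedTime μ '' {τ | IsPolicy hX n τ})

/-- The first time `i > σ` with `X i ∈ [x, x + s (1 - x)]`, where `x = X σ`
(and `⊤` if there is none). -/
def nextTime {Ω : Type*} (X : ℕ → Ω → ℝ) (s : ℝ) (σ : Ω → ℕ∞) (ω : Ω) : ℕ∞ :=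
  ⨅ (i : ℕ) (_ : σ ω < i ∧ X i ω ∈ Icc (stoppedValue X σ ω)
    (stoppedValue X σ ω + s * (1 - stoppedValue X σ ω))), (i : ℕ∞)

/-- The threshold recursion for the parameters `t_1, …, t_n`, stored as `t 0, …, t (n - 1)`:
`τ 0 = 0`, and `τ (k + 1)` is chosen after `τ k` with the parameter `t_{n-k}`, which is
`t k.rev`. -/
def thresholdPolicy {Ω : Type*} (X : ℕ → Ω → ℝ) {n : ℕ} (t : Fin n → ℝ) :
    Fin (n + 1) → Ω → ℕ∞ :=
  Fin.induction (motive := fun _ => Ω → ℕ∞) (fun _ => 0) fun k τk => nextTime X (t k.rev) τk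

/-- The parameters `t_1, …, t_n ∈ [0, 1]` define a threshold policy in `Π(n)` whose expected
completion time is `β(n)`. -/
structure IsOptimalThreshold {Ω : Type*} [MeasurableSpace Ω] {X : ℕ → Ω → ℝ} {μ : Measure Ω}
    (hX : IsUniformSequence X μ) (n : ℕ) (t : Fin n → ℝ) : Prop where
  mem_Icc : ∀ i, t i ∈ Icc (0 : ℝ) 1
  isPolicy : IsPolicy hX n (thresholdPolicy X t)
  attains : expectedTime μ (thresholdPolicy X t) = beta hX n

/-- The completion time of the threshold policy with parameters `t`, as a real random variable. -/
def thresholdCompletion {Ω : Type*} (X : ℕ → Ω → ℝ) {n : ℕ} (t : Fin n → ℝ) (ω : Ω) : ℝ :=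
  ((completionTime (thresholdPolicy X t) ω).toNat : ℝ)

end

end MonotoneSelection

namespace MonotoneSelection

/-! Everything rests on self-similarity. Above a level x only a fraction 1 - x of the observations
is usable, and these are uniform on [x, 1], so the least expected time for j more selections from x
should be b_j / (1 - x), where b_j = β(j). In the optimality equation a value u is then worth
accepting exactly when b_j / (1 - u) ≤ b_{j+1} / (1 - x), that is, when (u - x) / (1 - x) ≤ 1 - b_j
/ b_{j+1}. This is the optimal threshold, and the equation reduces to b_{j+1} - b_j - b_j log
(b_{j+1} / b_j) = 1, which serves as the definition of `optimalTime`.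

Under a threshold rule the waiting time is geometric and the accepted value is uniform on the window
(`lintegral_nextTime`). Hence the potential E[τ_k + b_{n-k} / (1 - X_{τ_k})] is constant along the
optimal policy, and by strict concavity of the logarithm any other threshold raises it strictly;
this gives attainment and uniqueness. The lower bound over all policies is a verification argument
(`verification_stage`), run with a truncation of b_j / (1 - x) because it needs a bounded function.

For the variance, a geometric G with parameter p has E[G (G + 1)] = 2 / p², so E[T (T + 1)] scales
exactly like (1 - x)⁻² and its recursion can be solved: it equals b_n ∑ 2 / t_i, whence Var T = b_n
(∑ 2 / t_i - b_n - 1). The increments d of b satisfy d² = 2 b + (4/3) d + O(d² / b). Thus b_n = n² /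
2 + O(n log n) and ∑ 2 / t_i - b_n = 2 n / 3 + O(log n); the product is n³ / 3 + O(n² log n), which
is stronger than required. -/

lemma stoppedValue_of_eq {Ω : Type*} {X : ℕ → Ω → ℝ} {σ : Ω → ℕ∞} {m : ℕ} {ω : Ω}
    (h : σ ω = m) : stoppedValue X σ ω = X m ω := by
  unfold stoppedValue
  rw [h]
  rfl

/-! ### Independence of the next observation from the past. -/

section Probability

variable {Ω : Type*} [mΩ : MeasurableSpace Ω] {μ : Measure Ω} {X : ℕ → Ω → ℝ}

lemma IsUniformSequence.measurable_filtration (hX : IsUniformSequence X μ) {i j : ℕ} (h : i ≤ j) :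
    Measurable[hX.filtration j] (X i) :=
  (comap_measurable (X i)).mono (le_iSup₂_of_le (f := fun k (_ : k ≤ j) =>
    MeasurableSpace.comap (X k) inferInstance) i h le_rfl) le_rfl

lemma IsUniformSequence.indep_filtration [IsProbabilityMeasure μ] (hX : IsUniformSequence X μ)
    (j : ℕ) :
    Indep (hX.filtration j) (MeasurableSpace.comap (X (j + 1)) inferInstance) μ := by
  have h := (hX.indep.indepFun_finset (Finset.range j) {j} (by simp)
    (fun i => hX.measurable (i + 1)))
  have h2 : IndepFun (fun ω (i : Finset.range j) => X (i + 1) ω) (X (j + 1)) μ :=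
    h.comp (φ := id) (ψ := fun v : ({j} : Finset ℕ) → ℝ => v ⟨j, by simp⟩) measurable_id
      (measurable_pi_apply _)
  refine indep_of_indep_of_le_left h2 (iSup₂_le fun i hi => ?_)
  rcases i with _ | i
  · have : X 0 = fun _ => 0 := funext hX.zero
    rw [this, MeasurableSpace.comap_const]
    exact bot_le
  · exact Measurable.comap_le
      ((measurable_pi_apply (⟨i, by simpa using hi⟩ : Finset.range j)).comp
        (comap_measurable (fun ω (i : Finset.range j) => X (i + 1) ω)))

lemma IsUniformSequence.map_eq (hX : IsUniformSequence X μ) (j : ℕ) :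
    μ.map (X (j + 1)) = volume.restrict (Icc (0 : ℝ) 1) := by
  have := hX.uniform j
  rw [pdf.IsUniform] at this
  rw [this, ProbabilityTheory.cond]
  simp

/-- Integrating out an observation that is independent of the past. -/
lemma IsUniformSequence.setLIntegral_next [IsProbabilityMeasure μ] (hX : IsUniformSequence X μ)
    {j : ℕ} {A : Set Ω} (hA : MeasurableSet[hX.filtration j] A) {Z : Ω → ℝ}
    (hZ : Measurable[hX.filtration j] Z) {g : ℝ → ℝ → ℝ≥0∞} (hg : Measurable (Function.uncurry g)) :
    ∫⁻ ω in A, g (Z ω) (X (j + 1) ω) ∂μ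
      = ∫⁻ ω in A, (∫⁻ u in Icc (0 : ℝ) 1, g (Z ω) u) ∂μ := by
  have hZ' : Measurable Z := hZ.mono (hX.filtration.le j) le_rfl
  have hA' : MeasurableSet A := hX.filtration.le j _ hA
  -- Restricted to `A`, the pair has a product law, because `Z ⁻¹' s ∩ A` still belongs to the past.
  have key : (μ.restrict A).map (fun ω => (Z ω, X (j + 1) ω))
      = ((μ.restrict A).map Z).prod (volume.restrict (Icc (0 : ℝ) 1)) := by
    symm
    refine Measure.prod_eq fun s t hs ht => ?_
    have hm : Measurable fun ω => (Z ω, X (j + 1) ω) := hZ'.prodMk (hX.measurable _)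
    rw [Measure.map_apply hm (hs.prod ht), Measure.map_apply hZ' hs, ← hX.map_eq j,
      Measure.map_apply (hX.measurable _) ht, Measure.restrict_apply (hm (hs.prod ht)),
      Measure.restrict_apply (hZ' hs)]
    have := (Indep_iff _ _ μ).1 (hX.indep_filtration j) (Z ⁻¹' s ∩ A) (X (j + 1) ⁻¹' t)
      ((hZ hs).inter hA) ⟨t, ht, rfl⟩
    rw [← this]
    congr 1
    ext ω
    simp only [mem_inter_iff, mem_preimage, mem_prod]
    tauto
  calc ∫⁻ ω in A, g (Z ω) (X (j + 1) ω) ∂μ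
      = ∫⁻ p, Function.uncurry g p ∂((μ.restrict A).map (fun ω => (Z ω, X (j + 1) ω))) := by
        rw [lintegral_map hg (hZ'.prodMk (hX.measurable _))]; rfl
    _ = ∫⁻ z, (∫⁻ u in Icc (0 : ℝ) 1, g z u) ∂((μ.restrict A).map Z) := by
        rw [key, lintegral_prod _ hg.aemeasurable]; rfl
    _ = _ := by
        exact lintegral_map hg.lintegral_prod_right' hZ'

lemma IsUniformSequence.ae_mem_Ico [IsProbabilityMeasure μ] (hX : IsUniformSequence X μ) :
    ∀ᵐ ω ∂μ, ∀ i, X i ω ∈ Ico (0 : ℝ) 1 := by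
  refine ae_all_iff.2 fun i => ?_
  rcases i with _ | j
  · simp [hX.zero]
  · have : ∀ᵐ x ∂(μ.map (X (j + 1))), x ∈ Ico (0 : ℝ) 1 := by
      rw [hX.map_eq j, ← restrict_Ico_eq_restrict_Icc]
      exact ae_restrict_mem measurableSet_Ico
    exact ae_of_ae_map (hX.measurable _).aemeasurable this

/-- Ties are null. This is what turns closed windows into strictly increasing selections. -/
lemma IsUniformSequence.ae_injective [IsProbabilityMeasure μ] (hX : IsUniformSequence X μ) :
    ∀ᵐ ω ∂μ, ∀ i j, i < j → X i ω ≠ X j ω := by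
  refine ae_all_iff.2 fun i => ae_all_iff.2 fun j => ?_
  rcases j with _ | j
  · simp
  by_cases hij : i < j + 1
  swap
  · simp [hij]
  have h := hX.setLIntegral_next (j := j) (A := univ) MeasurableSet.univ
    (hX.measurable_filtration (Nat.lt_succ_iff.1 hij))
    (g := fun x u => ({p : ℝ × ℝ | p.1 = p.2}.indicator 1 (x, u)))
    (measurable_one.indicator (measurableSet_eq_fun measurable_fst measurable_snd))
  have h0 : ∀ x : ℝ, ∫⁻ u in Icc (0 : ℝ) 1, {p : ℝ × ℝ | p.1 = p.2}.indicator
      (1 : ℝ × ℝ → ℝ≥0∞) (x, u) = 0 := by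
    intro x
    have : (fun u => {p : ℝ × ℝ | p.1 = p.2}.indicator (1 : ℝ × ℝ → ℝ≥0∞) (x, u))
        = ({x} : Set ℝ).indicator 1 := by
      ext u
      simp [indicator, eq_comm]
    rw [this, lintegral_indicator_one (measurableSet_singleton x)]
    simp
  simp only [h0, lintegral_zero, Measure.restrict_univ] at h
  rw [lintegral_eq_zero_iff] at h
  · filter_upwards [h] with ω hω _ heq
    simp [indicator, heq] at hω
  · exact (measurable_one.indicator (measurableSet_eq_fun measurable_fst measurable_snd)).comp
      ((hX.measurable _).prodMk (hX.measurable _))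

/-! ### Decomposition along the values of a stopping time. -/

section StoppingTimes

variable {ℱ : Filtration ℕ mΩ} {σ σ' : Ω → ℕ∞}

lemma stopping_measurableSet_eq (hσ : IsStoppingTime ℱ σ) (m : ℕ) :
    MeasurableSet[ℱ m] {ω | σ ω = m} :=
  hσ.measurableSet_eq m

lemma stopping_measurableSet_gt (hσ : IsStoppingTime ℱ σ) (m : ℕ) :
    MeasurableSet[ℱ m] {ω | (m : ℕ∞) < σ ω} :=
  hσ.measurableSet_gt m

lemma stopping_measurable_comp (hσ : IsStoppingTime ℱ σ) {β : Type*} [MeasurableSpace β]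
    (g : ℕ∞ → β) : Measurable fun ω => g (σ ω) := by
  have h1 : ∀ m : ℕ, MeasurableSet {ω | σ ω = m} := fun m =>
    ℱ.le m _ (stopping_measurableSet_eq hσ m)
  have h : @Measurable Ω ℕ∞ mΩ ⊤ σ := by
    refine @measurable_to_countable' ℕ∞ Ω ⊤ _ mΩ σ fun a => ?_
    induction a with
    | top =>
      have : σ ⁻¹' {⊤} = (⋃ m : ℕ, {ω | σ ω = m})ᶜ := by
        ext ω
        simp only [mem_preimage, mem_singleton_iff, mem_compl_iff, mem_iUnion, mem_ofPred_eq,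
          not_exists]
        exact ⟨fun h m => by simp [h], fun h => by
          by_contra h'
          obtain ⟨m, hm⟩ := ENat.ne_top_iff_exists.1 h'
          exact h m hm.symm⟩
      rw [this]
      exact (MeasurableSet.iUnion h1).compl
    | coe m => exact h1 m
  exact (@measurable_from_top ℕ∞ β _ g).comp h

lemma stopping_measurable_lintegrand (hσ : IsStoppingTime ℱ σ) :
    Measurable fun ω => (σ ω : ℝ≥0∞) :=
  stopping_measurable_comp hσ _

lemma stopping_measurable_stoppedValue (hσ : IsStoppingTime ℱ σ) (hX : ∀ i, Measurable (X i)) :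
    Measurable (stoppedValue X σ) := by
  have h : Measurable (Function.uncurry X) := measurable_from_prod_countable_right hX
  exact h.comp ((stopping_measurable_comp hσ
    (fun a : ℕ∞ => (WithTop.untopA a : ℕ))).prodMk measurable_id)

/-- Splitting an integral according to the value of a finite stopping time. -/
lemma setLIntegral_stopping (hσ : IsStoppingTime ℱ σ) (f : Ω → ℝ≥0∞) :
    ∫⁻ ω in {ω | σ ω < ⊤}, f ω ∂μ = ∑' m : ℕ, ∫⁻ ω in {ω | σ ω = m}, f ω ∂μ := by
  have : {ω | σ ω < ⊤} = ⋃ m : ℕ, {ω | σ ω = m} := by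
    ext ω
    simp only [mem_ofPred_eq, mem_iUnion, lt_top_iff_ne_top, ENat.ne_top_iff_exists, eq_comm]
  rw [this, lintegral_iUnion]
  · exact fun m => ℱ.le m _ (stopping_measurableSet_eq hσ m)
  · intro m m' hm
    refine disjoint_left.2 fun ω h h' => hm ?_
    simp only [mem_ofPred_eq] at h h'
    exact_mod_cast h.symm.trans h'

lemma lintegral_stopping (hσ : IsStoppingTime ℱ σ) (hfin : ∀ᵐ ω ∂μ, σ ω < ⊤) (f : Ω → ℝ≥0∞) :
    ∫⁻ ω, f ω ∂μ = ∑' m : ℕ, ∫⁻ ω in {ω | σ ω = m}, f ω ∂μ := by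
  rw [← setLIntegral_stopping hσ, ← setLIntegral_univ]
  refine (setLIntegral_congr ?_).symm
  filter_upwards [hfin] with ω h
  exact propext ⟨fun _ => trivial, fun _ => h⟩

/-- A later stopping time splits each event `{σ = m}` further. -/
lemma setLIntegral_stopping_lt (hσ : IsStoppingTime ℱ σ) (hσ' : IsStoppingTime ℱ σ')
    (f : Ω → ℝ≥0∞) (m : ℕ) (hlt : ∀ᵐ ω ∂μ, σ ω = m → σ ω < σ' ω) :
    ∫⁻ ω in {ω | σ ω = m} ∩ {ω | σ' ω < ⊤}, f ω ∂μ
      = ∑' i : ℕ, ∫⁻ ω in {ω | σ ω = m ∧ σ' ω = (m + i + 1 : ℕ)}, f ω ∂μ := by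
  have h1 : ∀ i : ℕ, MeasurableSet {ω | σ ω = m ∧ σ' ω = (m + i + 1 : ℕ)} := fun i =>
    (ℱ.le m _ (stopping_measurableSet_eq hσ m)).inter
      (ℱ.le _ _ (stopping_measurableSet_eq hσ' (m + i + 1)))
  have h2 : ({ω | σ ω = m} ∩ {ω | σ' ω < ⊤} : Set Ω)
      =ᵐ[μ] (⋃ i : ℕ, {ω | σ ω = m ∧ σ' ω = (m + i + 1 : ℕ)} : Set Ω) := by
    filter_upwards [hlt] with ω hω
    refine propext ⟨fun h => ?_, fun h => ?_⟩
    · obtain ⟨ha, hb⟩ := h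
      simp only [mem_ofPred_eq] at ha hb
      obtain ⟨n, hn⟩ := ENat.ne_top_iff_exists.1 hb.ne
      have := hω ha
      rw [ha, ← hn] at this
      have hmn : m < n := by exact_mod_cast this
      refine mem_iUnion.2 ⟨n - m - 1, ha, ?_⟩
      rw [← hn]
      congr 1
      omega
    · obtain ⟨i, ha, hb⟩ := mem_iUnion.1 h
      exact ⟨ha, by simp only [mem_ofPred_eq, hb]; exact ENat.natCast_lt_top _⟩
  rw [setLIntegral_congr h2, lintegral_iUnion h1]
  intro i j hij
  refine disjoint_left.2 fun ω h h' => hij ?_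
  have : ((m + i + 1 : ℕ) : ℕ∞) = (m + j + 1 : ℕ) := h.2.symm.trans h'.2
  have : m + i + 1 = m + j + 1 := by exact_mod_cast this
  omega

/-- The tail-sum formula for a - m, in additive form so that it also covers a = ⊤. -/
lemma natCast_add_tsum_lt (a : ℕ∞) (m : ℕ) (h : (m : ℕ∞) ≤ a) :
    (m : ℝ≥0∞) + ∑' i : ℕ, (if ((m + i : ℕ) : ℕ∞) < a then 1 else 0) = (a : ℝ≥0∞) := by
  induction a with
  | top =>
    have : ∀ i : ℕ, ((m + i : ℕ) : ℕ∞) < ⊤ := fun i => ENat.natCast_lt_top _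
    simp only [this, if_true]
    rw [ENNReal.tsum_const_eq_top_of_ne_zero one_ne_zero]
    simp
  | coe n =>
    obtain ⟨d, rfl⟩ := Nat.exists_eq_add_of_le (by exact_mod_cast h : m ≤ n)
    rw [tsum_eq_sum (s := Finset.range d)]
    · rw [Finset.sum_congr rfl (g := fun _ => (1 : ℝ≥0∞))]
      · simp
      · intro i hi
        rw [if_pos]
        have : i < d := by simpa using hi
        exact_mod_cast (by omega : m + i < m + d)
    · intro i hi
      rw [if_neg]
      have : d ≤ i := by simpa using hi
      intro h'
      have : m + i < m + d := by exact_mod_cast h'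
      omega

end StoppingTimes

end Probability

/-- The set of values that the threshold `s` accepts from the level `x`. -/
def window (s x : ℝ) : Set ℝ := Icc x (x + s * (1 - x))

lemma window_subset {s x : ℝ} (hs : s ∈ Icc (0 : ℝ) 1) (hx : x ∈ Ico (0 : ℝ) 1) :
    window s x ⊆ Icc 0 1 := by
  refine Icc_subset_Icc hx.1 ?_
  nlinarith [hs.2, hx.2]

lemma volume_window (s x : ℝ) : volume (window s x) = ENNReal.ofReal (s * (1 - x)) := by
  simp [window]

lemma measurableSet_window (s x : ℝ) : MeasurableSet (window s x) := measurableSet_Icc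

lemma volume_compl_window {s x : ℝ} (hs : s ∈ Icc (0 : ℝ) 1) (hx : x ∈ Ico (0 : ℝ) 1) :
    volume (Icc 0 1 ∩ (window s x)ᶜ) = ENNReal.ofReal (1 - s * (1 - x)) := by
  rw [← sdiff_eq, measure_sdiff (window_subset hs hx) (measurableSet_window s x).nullMeasurableSet
    (by rw [volume_window]; exact ENNReal.ofReal_ne_top), volume_window, Real.volume_Icc,
    ENNReal.ofReal_sub _ (mul_nonneg hs.1 (by linarith [hx.2]))]
  simp

lemma measurableSet_mem_window (s : ℝ) : MeasurableSet {p : ℝ × ℝ | p.2 ∈ window s p.1} :=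
  (measurableSet_le measurable_fst measurable_snd).inter
    (measurableSet_le measurable_snd (by fun_prop : Measurable fun p : ℝ × ℝ =>
      p.1 + s * (1 - p.1)))

lemma measurable_indicator_window (s : ℝ) {f : ℝ → ℝ → ℝ≥0∞}
    (hf : Measurable (Function.uncurry f)) :
    Measurable (Function.uncurry fun x u => (window s x).indicator (f x) u) := by
  exact hf.indicator (measurableSet_mem_window s)

lemma measurable_setLIntegral_window (s : ℝ) {f : ℝ → ℝ≥0∞} (hf : Measurable f) :
    Measurable fun x => ∫⁻ u in window s x, f u := by
  have := (measurable_indicator_window s (f := fun _ => f)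
    (hf.comp measurable_snd)).lintegral_prod_right' (ν := volume)
  simpa only [Function.uncurry_apply_pair, lintegral_indicator (measurableSet_window s _)]
    using this

/-! ### The waiting time of a threshold rule, pathwise. -/

section NextTime

variable {Ω : Type*} {X : ℕ → Ω → ℝ} {s : ℝ} {σ : Ω → ℕ∞} {ω : Ω}

lemma nextTime_le_iff (n : ℕ) : nextTime X s σ ω ≤ n ↔
    ∃ i ≤ n, σ ω < i ∧ X i ω ∈ window s (stoppedValue X σ ω) := by
  constructor
  · intro h
    have h1 : nextTime X s σ ω < ((n + 1 : ℕ) : ℕ∞) :=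
      h.trans_lt (by exact_mod_cast Nat.lt_succ_self n)
    rw [nextTime, iInf_lt_iff] at h1
    obtain ⟨i, hi⟩ := h1
    rw [iInf_lt_iff] at hi
    obtain ⟨hP, hi⟩ := hi
    exact ⟨i, Nat.lt_succ_iff.1 (by exact_mod_cast hi), hP⟩
  · rintro ⟨i, hin, hP⟩
    exact (iInf₂_le i hP).trans (by exact_mod_cast hin)

lemma lt_nextTime (h : σ ω < ⊤) : σ ω < nextTime X s σ ω := by
  obtain ⟨m, hm⟩ := ENat.ne_top_iff_exists.1 h.ne
  rw [← hm]
  by_contra h'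
  obtain ⟨i, hi, hlt, -⟩ := (nextTime_le_iff m).1 (not_lt.1 h')
  rw [← hm] at hlt
  have : m < i := by exact_mod_cast hlt
  omega

lemma succ_lt_nextTime_iff {m : ℕ} (hm : σ ω = m) (i : ℕ) :
    ((m + i + 1 : ℕ) : ℕ∞) < nextTime X s σ ω ↔
      ((m + i : ℕ) : ℕ∞) < nextTime X s σ ω ∧ X (m + i + 1) ω ∉ window s (X m ω) := by
  rw [← not_le, ← not_le, nextTime_le_iff, nextTime_le_iff, hm, stoppedValue_of_eq hm]
  constructor
  · intro h
    refine ⟨fun ⟨j, hj, hP⟩ => h ⟨j, by omega, hP⟩, fun hw => h ⟨m + i + 1, le_rfl, ?_, hw⟩⟩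
    exact_mod_cast (by omega : m < m + i + 1)
  · rintro ⟨h1, h2⟩ ⟨j, hj, hP⟩
    rcases Nat.lt_or_eq_of_le hj with hj | rfl
    · exact h1 ⟨j, by omega, hP⟩
    · exact h2 hP.2

lemma nextTime_eq_succ_iff {m : ℕ} (hm : σ ω = m) (i : ℕ) :
    nextTime X s σ ω = (m + i + 1 : ℕ) ↔
      ((m + i : ℕ) : ℕ∞) < nextTime X s σ ω ∧ X (m + i + 1) ω ∈ window s (X m ω) := by
  have h1 := succ_lt_nextTime_iff (X := X) (s := s) hm i
  have h2 : nextTime X s σ ω = (m + i + 1 : ℕ) ↔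
      ((m + i : ℕ) : ℕ∞) < nextTime X s σ ω ∧ ¬ ((m + i + 1 : ℕ) : ℕ∞) < nextTime X s σ ω := by
    induction nextTime X s σ ω with
    | top => simp [-Nat.cast_add, ENat.natCast_lt_top]
    | coe n =>
      norm_cast
      omega
  tauto

end NextTime

/-! ### The transition law of a threshold rule. -/

section Transition

variable {Ω : Type*} [mΩ : MeasurableSpace Ω] {μ : Measure Ω} {X : ℕ → Ω → ℝ}

lemma IsUniformSequence.isStoppingTime_nextTime (hX : IsUniformSequence X μ) {σ : Ω → ℕ∞}
    (hσ : IsStoppingTime hX.filtration σ) (s : ℝ) :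
    IsStoppingTime hX.filtration (nextTime X s σ) := by
  intro n
  have : {ω | nextTime X s σ ω ≤ n} = ⋃ i ∈ Iic n, ⋃ m ∈ Iio i,
      {ω | σ ω = m} ∩ {ω | X i ω ∈ window s (X m ω)} := by
    ext ω
    simp only [mem_ofPred_eq, mem_iUnion, mem_Iic, mem_Iio, mem_inter_iff]
    rw [nextTime_le_iff]
    constructor
    · rintro ⟨i, hi, hlt, hw⟩
      obtain ⟨m, hm⟩ := ENat.ne_top_iff_exists.1 hlt.ne_top
      rw [stoppedValue_of_eq hm.symm] at hw
      rw [← hm] at hlt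
      exact ⟨i, hi, m, by exact_mod_cast hlt, hm.symm, hw⟩
    · rintro ⟨i, hi, m, hlt, hm, hw⟩
      exact ⟨i, hi, by rw [hm]; exact_mod_cast hlt, by rwa [stoppedValue_of_eq hm]⟩
  change MeasurableSet[hX.filtration n] {ω | nextTime X s σ ω ≤ n}
  rw [this]
  refine MeasurableSet.biUnion (to_countable _) fun i hi =>
    MeasurableSet.biUnion (to_countable _) fun m hm => ?_
  have hi' : i ≤ n := hi
  have hm' : m ≤ n := le_of_lt (lt_of_lt_of_le hm hi')
  have h1 := hX.measurable_filtration hi'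
  have h2 := hX.measurable_filtration hm'
  refine (hX.filtration.mono hm' _ (stopping_measurableSet_eq hσ m)).inter
    ((measurableSet_le h2 h1).inter (measurableSet_le h1 (h2.add ((h2.const_sub 1).const_mul s))))

variable [IsProbabilityMeasure μ]

/-- The probability that a threshold rejects `i` consecutive observations. -/
lemma IsUniformSequence.setLIntegral_reject (hX : IsUniformSequence X μ) {σ : Ω → ℕ∞}
    (hσ : IsStoppingTime hX.filtration σ) {s : ℝ} (hs : s ∈ Icc (0 : ℝ) 1) (m i : ℕ)
    {h : ℝ → ℝ≥0∞} (hh : Measurable h) :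
    ∫⁻ ω in {ω | σ ω = m ∧ ((m + i : ℕ) : ℕ∞) < nextTime X s σ ω}, h (X m ω) ∂μ
      = ∫⁻ ω in {ω | σ ω = m}, ENNReal.ofReal (1 - s * (1 - X m ω)) ^ i * h (X m ω) ∂μ := by
  induction i generalizing h with
  | zero =>
    have : {ω | σ ω = m ∧ ((m + 0 : ℕ) : ℕ∞) < nextTime X s σ ω} = {ω | σ ω = m} := by
      ext ω
      refine ⟨fun h => h.1, fun h => ⟨h, ?_⟩⟩
      rw [add_zero, ← show σ ω = m from h]
      exact lt_nextTime (by rw [show σ ω = m from h]; exact ENat.natCast_lt_top m)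
    simp only [this, pow_zero, one_mul]
  | succ i ih =>
    set D := {ω | σ ω = m ∧ ((m + i : ℕ) : ℕ∞) < nextTime X s σ ω} with hD
    have hDm : MeasurableSet[hX.filtration (m + i)] D :=
      (hX.filtration.mono (Nat.le_add_right m i) _ (stopping_measurableSet_eq hσ m)).inter
        (stopping_measurableSet_gt (hX.isStoppingTime_nextTime hσ s) (m + i))
    have hset : {ω | σ ω = m ∧ ((m + (i + 1) : ℕ) : ℕ∞) < nextTime X s σ ω}
        = {ω | X (m + i + 1) ω ∈ (window s (X m ω))ᶜ} ∩ D := by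
      ext ω
      simp only [mem_ofPred_eq, mem_inter_iff, hD, mem_compl_iff]
      constructor
      · rintro ⟨h1, h2⟩
        have := (succ_lt_nextTime_iff h1 i).1 h2
        exact ⟨this.2, h1, this.1⟩
      · rintro ⟨h1, h2, h3⟩
        exact ⟨h2, (succ_lt_nextTime_iff h2 i).2 ⟨h3, h1⟩⟩
    have hg : Measurable (Function.uncurry fun x u =>
        (window s x)ᶜ.indicator (fun _ => h x) u) := by
      exact (hh.comp measurable_fst).indicator (measurableSet_mem_window s).compl
    have hXm : MeasurableSet {ω | X (m + i + 1) ω ∈ (window s (X m ω))ᶜ} :=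
      (((hX.measurable m).prodMk (hX.measurable _)) (measurableSet_mem_window s)).compl
    calc _ = ∫⁻ ω in D, (window s (X m ω))ᶜ.indicator (fun _ => h (X m ω)) (X (m + i + 1) ω) ∂μ := by
          rw [hset, ← Measure.restrict_restrict hXm, ← lintegral_indicator hXm]
          rfl
      _ = ∫⁻ ω in D, (∫⁻ u in Icc (0 : ℝ) 1, (window s (X m ω))ᶜ.indicator
            (fun _ => h (X m ω)) u) ∂μ :=
          hX.setLIntegral_next hDm (hX.measurable_filtration (Nat.le_add_right m i)) hg
      _ = ∫⁻ ω in D, ENNReal.ofReal (1 - s * (1 - X m ω)) * h (X m ω) ∂μ := by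
          refine lintegral_congr_ae (ae_restrict_of_ae ?_)
          filter_upwards [hX.ae_mem_Ico] with ω hω
          rw [lintegral_indicator (measurableSet_window _ _).compl, lintegral_const,
            Measure.restrict_restrict (measurableSet_window _ _).compl, Measure.restrict_apply_univ,
            inter_comm, volume_compl_window hs (hω m), mul_comm]
      _ = _ := by
          -- The induction hypothesis is used for `h` times the one-step rejection probability,
          -- hence the generalization over `h`.
          rw [ih (h := fun x => ENNReal.ofReal (1 - s * (1 - x)) * h x) (by fun_prop)]
          simp only [pow_succ, mul_assoc]

/-- The transition law of a threshold rule: the waiting time is geometric, and the accepted value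
is uniform on the window. -/
lemma IsUniformSequence.lintegral_nextTime (hX : IsUniformSequence X μ) {σ : Ω → ℕ∞}
    (hσ : IsStoppingTime hX.filtration σ) (hfin : ∀ᵐ ω ∂μ, σ ω < ⊤) {s : ℝ}
    (hs : s ∈ Icc (0 : ℝ) 1) {f : ℕ → ℝ → ℝ≥0∞} (hf : ∀ n, Measurable (f n)) :
    ∫⁻ ω in {ω | nextTime X s σ ω < ⊤},
        f (nextTime X s σ ω).toNat (stoppedValue X (nextTime X s σ) ω) ∂μ
      = ∫⁻ ω, ∑' i : ℕ, ENNReal.ofReal (1 - s * (1 - stoppedValue X σ ω)) ^ i *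
          ∫⁻ u in window s (stoppedValue X σ ω), f ((σ ω).toNat + i + 1) u ∂volume ∂μ := by
  set σ' := nextTime X s σ with hσ'
  have hst := hX.isStoppingTime_nextTime hσ s
  have hm : ∀ m : ℕ, MeasurableSet {ω | σ ω = m} := fun m =>
    hX.filtration.le m _ (stopping_measurableSet_eq hσ m)
  have hF := fun n => measurable_setLIntegral_window s (hf n)
  rw [lintegral_stopping hσ (ae_restrict_of_ae hfin), lintegral_stopping hσ hfin]
  refine tsum_congr fun m => ?_
  rw [Measure.restrict_restrict (hm m), setLIntegral_stopping_lt hσ hst _ m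
    (ae_of_all _ fun ω h => lt_nextTime (by rw [h]; exact ENat.natCast_lt_top m))]
  rw [setLIntegral_congr_fun (g := fun ω => ∑' i : ℕ, ENNReal.ofReal (1 - s * (1 - X m ω)) ^ i *
          ∫⁻ u in window s (X m ω), f (m + i + 1) u) (hm m), lintegral_tsum]
  rotate_left
  · intro i
    exact (((((hX.measurable m).const_sub 1).const_mul s).const_sub 1).ennreal_ofReal.pow_const
      i |>.mul ((hF (m + i + 1)).comp (hX.measurable m))).aemeasurable
  · intro ω h
    have h' : σ ω = m := h
    simp only [stoppedValue_of_eq h', h', ENat.toNat_natCast]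
  refine tsum_congr fun i => ?_
  rw [← hX.setLIntegral_reject hσ hs m i (hF (m + i + 1))]
  set D := {ω | σ ω = m ∧ ((m + i : ℕ) : ℕ∞) < nextTime X s σ ω} with hD
  have hDm : MeasurableSet[hX.filtration (m + i)] D :=
    (hX.filtration.mono (Nat.le_add_right m i) _ (stopping_measurableSet_eq hσ m)).inter
      (stopping_measurableSet_gt hst (m + i))
  have hXm : MeasurableSet {ω | X (m + i + 1) ω ∈ window s (X m ω)} :=
    ((hX.measurable m).prodMk (hX.measurable _)) (measurableSet_mem_window s)
  have hset : {ω | σ ω = m ∧ σ' ω = (m + i + 1 : ℕ)}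
      = {ω | X (m + i + 1) ω ∈ window s (X m ω)} ∩ D := by
    ext ω
    simp only [mem_ofPred_eq, mem_inter_iff, hD]
    constructor
    · rintro ⟨h1, h2⟩
      have := (nextTime_eq_succ_iff h1 i).1 h2
      exact ⟨this.2, h1, this.1⟩
    · rintro ⟨h1, h2, h3⟩
      exact ⟨h2, (nextTime_eq_succ_iff h2 i).2 ⟨h3, h1⟩⟩
  have hmeas : MeasurableSet {ω | σ ω = m ∧ σ' ω = (m + i + 1 : ℕ)} := by
    rw [hset]
    exact hXm.inter (hX.filtration.le _ _ hDm)
  calc _ = ∫⁻ ω in {ω | σ ω = m ∧ σ' ω = (m + i + 1 : ℕ)}, f (m + i + 1) (X (m + i + 1) ω) ∂μ := by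
        refine setLIntegral_congr_fun hmeas fun ω h => ?_
        have h' : σ' ω = (m + i + 1 : ℕ) := h.2
        simp only [h', stoppedValue_of_eq h', ENat.toNat_natCast]
    _ = ∫⁻ ω in D, (window s (X m ω)).indicator (f (m + i + 1)) (X (m + i + 1) ω) ∂μ := by
        rw [hset, ← Measure.restrict_restrict hXm, ← lintegral_indicator hXm]
        rfl
    _ = ∫⁻ ω in D, (∫⁻ u in Icc (0 : ℝ) 1, (window s (X m ω)).indicator
          (f (m + i + 1)) u) ∂μ :=
        hX.setLIntegral_next hDm (hX.measurable_filtration (Nat.le_add_right m i))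
          (measurable_indicator_window s (f := fun _ => f (m + i + 1))
            ((hf _).comp measurable_snd))
    _ = _ := by
        refine lintegral_congr_ae (ae_restrict_of_ae ?_)
        filter_upwards [hX.ae_mem_Ico] with ω hω
        rw [lintegral_indicator (measurableSet_window _ _),
          Measure.restrict_restrict (measurableSet_window _ _),
          inter_eq_left.2 (window_subset hs (hω m))]

end Transition

/-! ### Verification: lower bounds for arbitrary policies. -/

section LowerBound

variable {Ω : Type*} [mΩ : MeasurableSpace Ω] {μ : Measure Ω}
  {X : ℕ → Ω → ℝ} {σ σ' : Ω → ℕ∞}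

lemma setLIntegral_gap {ℱ : Filtration ℕ mΩ} (hσ : IsStoppingTime ℱ σ)
    (hσ' : IsStoppingTime ℱ σ') (hlt : ∀ᵐ ω ∂μ, σ ω < σ' ω) (m : ℕ) :
    ∫⁻ ω in {ω | σ ω = m}, (σ ω : ℝ≥0∞) ∂μ
        + ∑' i : ℕ, μ {ω | σ ω = m ∧ ((m + i : ℕ) : ℕ∞) < σ' ω}
      = ∫⁻ ω in {ω | σ ω = m}, (σ' ω : ℝ≥0∞) ∂μ := by
  have hm : MeasurableSet {ω | σ ω = m} := ℱ.le m _ (stopping_measurableSet_eq hσ m)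
  have hgt : ∀ n : ℕ, MeasurableSet {ω | (n : ℕ∞) < σ' ω} := fun n =>
    ℱ.le n _ (stopping_measurableSet_gt hσ' n)
  have h1 : ∀ i : ℕ, μ {ω | σ ω = m ∧ ((m + i : ℕ) : ℕ∞) < σ' ω}
      = ∫⁻ ω in {ω | σ ω = m}, (if ((m + i : ℕ) : ℕ∞) < σ' ω then 1 else 0) ∂μ := by
    intro i
    have : (fun ω => if ((m + i : ℕ) : ℕ∞) < σ' ω then (1 : ℝ≥0∞) else 0)
        = {ω | ((m + i : ℕ) : ℕ∞) < σ' ω}.indicator 1 := by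
      ext ω
      simp [indicator]
    rw [this, lintegral_indicator_one (hgt _), Measure.restrict_apply (hgt _), inter_comm]
    rfl
  simp only [h1]
  rw [← lintegral_tsum fun i => (stopping_measurable_comp hσ' (fun a : ℕ∞ =>
      if ((m + i : ℕ) : ℕ∞) < a then (1 : ℝ≥0∞) else 0)).aemeasurable,
    ← lintegral_add_left (stopping_measurable_lintegrand hσ)]
  refine setLIntegral_congr_fun_ae hm ?_
  filter_upwards [hlt] with ω h1 h2
  have h3 : σ ω = m := h2
  rw [h3] at h1 ⊢
  exact natCast_add_tsum_lt _ _ h1.le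

variable [IsProbabilityMeasure μ]

/-- The subsolution inequality is integrated against the next observation on the event that nothing
has been selected up to time m + i. A selection leads to `V'` at a larger value, a rejection leaves
`V` at x, and the minimum lies below whichever of the two the policy chooses. -/
lemma IsUniformSequence.reject_step (hX : IsUniformSequence X μ)
    (hσ : IsStoppingTime hX.filtration σ) (hσ' : IsStoppingTime hX.filtration σ')
    (hval : ∀ᵐ ω ∂μ, stoppedValue X σ ω < stoppedValue X σ' ω) {V V' : ℝ → ℝ≥0∞}
    (hVm : Measurable V) (hVm' : Measurable V')
    (hV : ∀ x ∈ Ico (0 : ℝ) 1,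
      V x ≤ 1 + ∫⁻ u in Icc (0 : ℝ) 1, if x < u then min (V x) (V' u) else V x) (m i : ℕ) :
    ∫⁻ ω in {ω | σ ω = m ∧ ((m + i : ℕ) : ℕ∞) < σ' ω}, V (X m ω) ∂μ
      ≤ (μ {ω | σ ω = m ∧ ((m + i : ℕ) : ℕ∞) < σ' ω}
        + ∫⁻ ω in {ω | σ ω = m ∧ σ' ω = (m + i + 1 : ℕ)}, V' (stoppedValue X σ' ω) ∂μ)
        + ∫⁻ ω in {ω | σ ω = m ∧ ((m + (i + 1) : ℕ) : ℕ∞) < σ' ω}, V (X m ω) ∂μ := by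
  set D := {ω | σ ω = m ∧ ((m + i : ℕ) : ℕ∞) < σ' ω} with hD
  set D' := {ω | σ ω = m ∧ ((m + (i + 1) : ℕ) : ℕ∞) < σ' ω} with hD'
  set E := {ω | σ ω = m ∧ σ' ω = (m + i + 1 : ℕ)} with hE
  have hm : ∀ n, m ≤ n → MeasurableSet[hX.filtration n] {ω | σ ω = m} := fun n hn =>
    hX.filtration.mono hn _ (stopping_measurableSet_eq hσ m)
  have hDm : MeasurableSet[hX.filtration (m + i)] D :=
    (hm _ (Nat.le_add_right m i)).inter (stopping_measurableSet_gt hσ' (m + i))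
  have hDm' : MeasurableSet D' := hX.filtration.le (m + (i + 1)) _
    ((hm _ (Nat.le_add_right m _)).inter (stopping_measurableSet_gt hσ' _))
  have hEm : MeasurableSet E := hX.filtration.le (m + i + 1) _
    ((hm _ (by omega)).inter (stopping_measurableSet_eq hσ' (m + i + 1)))
  have hunion : D = E ∪ D' := by
    ext ω
    simp only [hD, hE, hD', mem_ofPred_eq, mem_union, ← and_or_left]
    refine and_congr_right fun _ => ?_
    induction σ' ω with
    | top => simp [-Nat.cast_add, ENat.natCast_lt_top]
    | coe n =>
      norm_cast
      omega
  have hdisj : Disjoint E D' := by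
    refine disjoint_left.2 fun ω h h' => ?_
    have := h'.2
    rw [h.2] at this
    have : m + (i + 1) < m + i + 1 := by exact_mod_cast this
    omega
  have hg : Measurable (Function.uncurry fun x u => if x < u then min (V x) (V' u) else V x) :=
    Measurable.ite (measurableSet_lt measurable_fst measurable_snd)
      ((hVm.comp measurable_fst).min (hVm'.comp measurable_snd)) (hVm.comp measurable_fst)
  calc ∫⁻ ω in D, V (X m ω) ∂μ
      ≤ ∫⁻ ω in D, (1 + ∫⁻ u in Icc (0 : ℝ) 1,
          if X m ω < u then min (V (X m ω)) (V' u) else V (X m ω)) ∂μ := by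
        refine lintegral_mono_ae (ae_restrict_of_ae ?_)
        filter_upwards [hX.ae_mem_Ico] with ω hω using hV _ (hω m)
    _ = μ D + ∫⁻ ω in D, (∫⁻ u in Icc (0 : ℝ) 1,
          if X m ω < u then min (V (X m ω)) (V' u) else V (X m ω)) ∂μ := by
        rw [lintegral_add_left measurable_const, setLIntegral_one]
    _ = μ D + ∫⁻ ω in D, (if X m ω < X (m + i + 1) ω
          then min (V (X m ω)) (V' (X (m + i + 1) ω)) else V (X m ω)) ∂μ := by
        rw [← hX.setLIntegral_next hDm (hX.measurable_filtration (Nat.le_add_right m i)) hg]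
    _ ≤ μ D + (∫⁻ ω in E, V' (stoppedValue X σ' ω) ∂μ + ∫⁻ ω in D', V (X m ω) ∂μ) := by
        gcongr
        rw [hunion, lintegral_union hDm' hdisj]
        refine add_le_add ?_ (lintegral_mono fun ω => ?_)
        · refine setLIntegral_mono_ae' hEm ?_
          filter_upwards [hval] with ω h1 h2
          have h3 : stoppedValue X σ' ω = X (m + i + 1) ω := stoppedValue_of_eq h2.2
          rw [stoppedValue_of_eq h2.1, h3] at h1
          rw [h3, if_pos h1]
          exact min_le_right _ _
        · split_ifs
          · exact min_le_left _ _
          · exact le_rfl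
    _ = _ := by rw [add_assoc]

/-- One stage of the verification argument: a bounded subsolution `V` of the optimality equation
bounds the cost of any selection from below. -/
lemma IsUniformSequence.verification_stage (hX : IsUniformSequence X μ)
    (hσ : IsStoppingTime hX.filtration σ) (hσ' : IsStoppingTime hX.filtration σ')
    (hlt : ∀ᵐ ω ∂μ, σ ω < σ' ω) (hfin : ∀ᵐ ω ∂μ, σ' ω < ⊤)
    (hval : ∀ᵐ ω ∂μ, stoppedValue X σ ω < stoppedValue X σ' ω) {V V' : ℝ → ℝ≥0∞}
    (hVm : Measurable V) (hVm' : Measurable V') {C : ℝ≥0∞} (hC : C ≠ ∞) (hVC : ∀ x, V x ≤ C)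
    (hV : ∀ x ∈ Ico (0 : ℝ) 1,
      V x ≤ 1 + ∫⁻ u in Icc (0 : ℝ) 1, if x < u then min (V x) (V' u) else V x) :
    ∫⁻ ω, (σ ω : ℝ≥0∞) ∂μ + ∫⁻ ω, V (stoppedValue X σ ω) ∂μ
      ≤ ∫⁻ ω, (σ' ω : ℝ≥0∞) ∂μ + ∫⁻ ω, V' (stoppedValue X σ' ω) ∂μ := by
  have hfinσ : ∀ᵐ ω ∂μ, σ ω < ⊤ := by
    filter_upwards [hlt] with ω h using h.trans_le le_top
  have hm : ∀ m : ℕ, MeasurableSet {ω | σ ω = m} := fun m =>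
    hX.filtration.le m _ (stopping_measurableSet_eq hσ m)
  let D : ℕ → ℕ → Set Ω := fun m i => {ω | σ ω = m ∧ ((m + i : ℕ) : ℕ∞) < σ' ω}
  have hD : ∀ m i, MeasurableSet (D m i) := fun m i => (hm m).inter
    (hX.filtration.le (m + i) _ (stopping_measurableSet_gt hσ' (m + i)))
  have hlim : ∀ m, Tendsto (fun M => μ (D m M)) atTop (nhds 0) := by
    intro m
    have hnull : μ (⋂ M, D m M) = 0 := by
      refine measure_mono_null (fun ω h => ?_) hfin
      simp only [mem_compl_iff, mem_ofPred_eq]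
      intro hω
      obtain ⟨n, hn⟩ := ENat.ne_top_iff_exists.1 hω.ne
      have := (mem_iInter.1 h n).2
      rw [← hn] at this
      have : m + n < n := by exact_mod_cast this
      omega
    rw [← hnull]
    refine tendsto_measure_iInter_atTop (fun i => (hD m i).nullMeasurableSet) ?_
      ⟨0, measure_ne_top _ _⟩
    intro i j hij ω h
    refine ⟨h.1, lt_of_le_of_lt ?_ h.2⟩
    exact_mod_cast (by omega : m + i ≤ m + j)
  have hiter : ∀ m M, ∫⁻ ω in D m 0, V (X m ω) ∂μ
      ≤ ∑ i ∈ Finset.range M, (μ (D m i)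
        + ∫⁻ ω in {ω | σ ω = m ∧ σ' ω = (m + i + 1 : ℕ)}, V' (stoppedValue X σ' ω) ∂μ)
        + ∫⁻ ω in D m M, V (X m ω) ∂μ := by
    intro m M
    induction M with
    | zero => simp
    | succ M ih =>
      refine ih.trans ?_
      rw [Finset.sum_range_succ, add_assoc]
      gcongr
      exact hX.reject_step hσ hσ' hval hVm hVm' hV m M
  have hstage : ∀ m : ℕ, ∫⁻ ω in {ω | σ ω = m}, V (stoppedValue X σ ω) ∂μ
      ≤ ∑' i, μ (D m i) + ∫⁻ ω in {ω | σ ω = m}, V' (stoppedValue X σ' ω) ∂μ := by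
    intro m
    have h0 : ∫⁻ ω in {ω | σ ω = m}, V (stoppedValue X σ ω) ∂μ
        = ∫⁻ ω in D m 0, V (X m ω) ∂μ := by
      rw [setLIntegral_congr_fun (g := fun ω => V (X m ω)) (hm m)
        fun ω h => by simp only [stoppedValue_of_eq h]]
      refine setLIntegral_congr ?_
      filter_upwards [hlt] with ω h
      refine propext ⟨fun h' => ⟨h', ?_⟩, fun h' => h'.1⟩
      rw [add_zero, ← show σ ω = m from h']
      exact h
    have h1 : ∑' i : ℕ, ∫⁻ ω in {ω | σ ω = m ∧ σ' ω = (m + i + 1 : ℕ)},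
        V' (stoppedValue X σ' ω) ∂μ ≤ ∫⁻ ω in {ω | σ ω = m}, V' (stoppedValue X σ' ω) ∂μ := by
      rw [← setLIntegral_stopping_lt hσ hσ' _ m (hlt.mono fun ω h _ => h)]
      exact lintegral_mono_set inter_subset_left
    rw [h0]
    refine le_trans ?_ (add_le_add_right h1 _)
    rw [← ENNReal.tsum_add]
    -- The remainder after M rejections is at most C times the probability of still waiting, which
    -- tends to 0. This is the only use of boundedness of `V`.
    have h2 : Tendsto (fun M => ∑' i, (μ (D m i)
        + ∫⁻ ω in {ω | σ ω = m ∧ σ' ω = (m + i + 1 : ℕ)}, V' (stoppedValue X σ' ω) ∂μ)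
        + C * μ (D m M)) atTop (nhds (∑' i, (μ (D m i)
        + ∫⁻ ω in {ω | σ ω = m ∧ σ' ω = (m + i + 1 : ℕ)}, V' (stoppedValue X σ' ω) ∂μ)
        + C * 0)) :=
      tendsto_const_nhds.add (ENNReal.Tendsto.const_mul (hlim m) (Or.inr hC))
    rw [mul_zero, add_zero] at h2
    refine ge_of_tendsto' h2 fun M => (hiter m M).trans ?_
    refine add_le_add (ENNReal.sum_le_tsum _) ?_
    rw [← setLIntegral_const]
    exact lintegral_mono fun ω => hVC _
  rw [lintegral_stopping hσ hfinσ (fun ω => (σ ω : ℝ≥0∞)),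
    lintegral_stopping hσ hfinσ (fun ω => (σ' ω : ℝ≥0∞)),
    lintegral_stopping hσ hfinσ (fun ω => V (stoppedValue X σ ω)),
    lintegral_stopping hσ hfinσ (fun ω => V' (stoppedValue X σ' ω)),
    ← ENNReal.tsum_add, ← ENNReal.tsum_add]
  refine ENNReal.tsum_le_tsum fun m => ?_
  rw [← setLIntegral_gap hσ hσ' hlt m, add_assoc]
  gcongr
  exact hstage m

end LowerBound

/-! ### Rational and polynomial bounds for the logarithm. -/

section LogBounds

lemma monotoneOn_Ici_of_hasDerivAt {f f' : ℝ → ℝ} (hf : ∀ y, 0 ≤ y → HasDerivAt f (f' y) y)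
    (hf' : ∀ y, 0 ≤ y → 0 ≤ f' y) {y : ℝ} (hy : 0 ≤ y) : f 0 ≤ f y := by
  have h : MonotoneOn f (Ici 0) := by
    refine monotoneOn_of_deriv_nonneg (convex_Ici 0)
      (fun y hy => (hf y hy).continuousAt.continuousWithinAt)
      (fun y hy => ?_) (fun y hy => ?_)
    · rw [interior_Ici] at hy
      exact (hf y (le_of_lt hy)).differentiableAt.differentiableWithinAt
    · rw [interior_Ici] at hy
      rw [(hf y (le_of_lt hy)).deriv]
      exact hf' y (le_of_lt hy)
  exact h self_mem_Ici hy hy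

lemma hasDerivAt_log_one_add {y : ℝ} (hy : 0 ≤ y) :
    HasDerivAt (fun y => Real.log (1 + y)) (1 / (1 + y)) y := by
  have := ((hasDerivAt_id y).const_add 1).log (by simp; linarith)
  simpa using this

/-- The right side is the [2/1] Padé approximant, exact to third order at 0; it produces the sharp
coefficient 4/3 in `increment_sq_le`. -/
lemma log_one_add_le_pade {y : ℝ} (hy : 0 ≤ y) :
    Real.log (1 + y) ≤ y * (6 + y) / (6 + 4 * y) := by
  have h := monotoneOn_Ici_of_hasDerivAt
    (f := fun y => y * (6 + y) / (6 + 4 * y) - Real.log (1 + y))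
    (f' := fun y => ((1 * (6 + y) + y * 1) * (6 + 4 * y) - y * (6 + y) * (4 * 1)) / (6 + 4 * y) ^ 2
      - 1 / (1 + y)) (fun y hy => ?_) (fun y hy => ?_) hy
  · simpa using h
  · exact (((hasDerivAt_id y).mul ((hasDerivAt_id y).const_add 6)).div
      (((hasDerivAt_id y).const_mul 4).const_add 6) (by simp; linarith)).sub
      (hasDerivAt_log_one_add hy)
  · have : ((1 * (6 + y) + y * 1) * (6 + 4 * y) - y * (6 + y) * (4 * 1)) / (6 + 4 * y) ^ 2
        - 1 / (1 + y) = 4 * y ^ 3 / ((6 + 4 * y) ^ 2 * (1 + y)) := by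
      field_simp
      ring
    rw [this]
    positivity

lemma le_log_one_add_quartic {y : ℝ} (hy : 0 ≤ y) :
    y - y ^ 2 / 2 + y ^ 3 / 3 - y ^ 4 / 4 ≤ Real.log (1 + y) := by
  have h := monotoneOn_Ici_of_hasDerivAt
    (f := fun y => Real.log (1 + y) - (y - y ^ 2 / 2 + y ^ 3 / 3 - y ^ 4 / 4))
    (f' := fun y => 1 / (1 + y) - (1 - 2 * y / 2 + 3 * y ^ 2 / 3 - 4 * y ^ 3 / 4))
    (fun y hy => ?_) (fun y hy => ?_) hy
  · simpa using h
  · have h1 := ((((hasDerivAt_id y).sub ((hasDerivAt_pow 2 y).div_const 2)).add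
      ((hasDerivAt_pow 3 y).div_const 3)).sub ((hasDerivAt_pow 4 y).div_const 4))
    exact ((hasDerivAt_log_one_add hy).sub h1).congr_deriv (by norm_num)
  · have : 1 / (1 + y) - (1 - 2 * y / 2 + 3 * y ^ 2 / 3 - 4 * y ^ 3 / 4) = y ^ 4 / (1 + y) := by
      field_simp
      ring
    rw [this]
    positivity

end LogBounds

/-! ### The recursion for the optimal times and thresholds. -/

section OptimalSequence

/-- Intermediate value theorem on [b, 3 b + 2], with the Padé bound at the right end. The condition
0 ≤ b sits inside the existential so that the recursion can be defined before nonnegativity is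
known. For b = 0 the logarithmic term vanishes and the equation reads b' = 1. -/
lemma exists_next_time (b : ℝ) :
    ∃ b' : ℝ, 0 ≤ b → b < b' ∧ b' - b - b * Real.log (b' / b) = 1 := by
  by_cases hb : 0 ≤ b
  swap
  · exact ⟨0, fun h => absurd h hb⟩
  rcases hb.eq_or_lt with rfl | hb
  · exact ⟨1, fun _ => by norm_num⟩
  have hcont : ContinuousOn (fun y => y - b - b * Real.log (y / b)) (Icc b (3 * b + 2)) := by
    have : ∀ y ∈ Icc b (3 * b + 2), y / b ≠ 0 := fun y hy =>
      (div_pos (hb.trans_le hy.1) hb).ne'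
    fun_prop (disch := assumption)
  have hend : 1 ≤ (3 * b + 2) - b - b * Real.log ((3 * b + 2) / b) := by
    have h1 := log_one_add_le_pade (y := (2 * b + 2) / b) (by positivity)
    rw [show 1 + (2 * b + 2) / b = (3 * b + 2) / b by field_simp; ring] at h1
    have h2 : b * Real.log ((3 * b + 2) / b)
        ≤ b * ((2 * b + 2) / b * (6 + (2 * b + 2) / b) / (6 + 4 * ((2 * b + 2) / b))) := by
      gcongr
    have h3 : b * ((2 * b + 2) / b * (6 + (2 * b + 2) / b) / (6 + 4 * ((2 * b + 2) / b)))
        ≤ 2 * b + 1 := by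
      have : b * ((2 * b + 2) / b * (6 + (2 * b + 2) / b) / (6 + 4 * ((2 * b + 2) / b)))
          = (2 * b + 2) * (8 * b + 2) / (14 * b + 8) := by
        field_simp
        ring
      rw [this, div_le_iff₀ (by positivity)]
      nlinarith
    linarith
  have hivt := intermediate_value_Icc (by linarith : b ≤ 3 * b + 2) hcont
  obtain ⟨y, hy, hy1⟩ := hivt (show (1 : ℝ) ∈ _ from
    ⟨by rw [div_self hb.ne']; simp, hend⟩)
  refine ⟨y, fun _ => ⟨lt_of_le_of_ne hy.1 ?_, hy1⟩⟩
  rintro rfl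
  simp [div_self hb.ne'] at hy1

/-- The minimal expected time `β(n)`, given by its recursion. -/
noncomputable def optimalTime : ℕ → ℝ
  | 0 => 0
  | n + 1 => Classical.choose (exists_next_time (optimalTime n))

lemma optimalTime_spec (n : ℕ) : 0 ≤ optimalTime n ∧ optimalTime n < optimalTime (n + 1) ∧
    optimalTime (n + 1) - optimalTime n
      - optimalTime n * Real.log (optimalTime (n + 1) / optimalTime n) = 1 := by
  have h : ∀ n, 0 ≤ optimalTime n := by
    intro n
    induction n with
    | zero => exact le_rfl
    | succ n ih => exact ih.trans (Classical.choose_spec (exists_next_time (optimalTime n)) ih).1.le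
  exact ⟨h n, Classical.choose_spec (exists_next_time (optimalTime n)) (h n)⟩

lemma optimalTime_zero : optimalTime 0 = 0 := rfl

lemma optimalTime_nonneg (n : ℕ) : 0 ≤ optimalTime n := (optimalTime_spec n).1

lemma optimalTime_lt_succ (n : ℕ) : optimalTime n < optimalTime (n + 1) := (optimalTime_spec n).2.1

lemma optimalTime_succ_pos (n : ℕ) : 0 < optimalTime (n + 1) :=
  (optimalTime_nonneg n).trans_lt (optimalTime_lt_succ n)

lemma optimalTime_equation (n : ℕ) : optimalTime (n + 1) - optimalTime n
      - optimalTime n * Real.log (optimalTime (n + 1) / optimalTime n) = 1 :=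
  (optimalTime_spec n).2.2

lemma optimalTime_one : optimalTime 1 = 1 := by
  simpa [optimalTime_zero] using optimalTime_equation 0

/-- The optimal threshold with `n + 1` selections remaining. -/
noncomputable def optimalThreshold (n : ℕ) : ℝ := 1 - optimalTime n / optimalTime (n + 1)

lemma optimalThreshold_pos (n : ℕ) : 0 < optimalThreshold n := by
  rw [optimalThreshold, sub_pos, div_lt_one (optimalTime_succ_pos n)]
  exact optimalTime_lt_succ n

lemma optimalThreshold_mem (n : ℕ) : optimalThreshold n ∈ Icc (0 : ℝ) 1 :=
  ⟨(optimalThreshold_pos n).le, by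
    have := div_nonneg (optimalTime_nonneg n) (optimalTime_nonneg (n + 1))
    rw [optimalThreshold]
    linarith⟩

lemma optimalThreshold_zero : optimalThreshold 0 = 1 := by
  simp [optimalThreshold, optimalTime_zero]

lemma optimalThreshold_succ_lt_one (n : ℕ) : optimalThreshold (n + 1) < 1 := by
  have := div_pos (optimalTime_succ_pos n) (optimalTime_succ_pos (n + 1))
  rw [optimalThreshold]
  linarith

lemma one_sub_optimalThreshold (n : ℕ) :
    1 - optimalThreshold n = optimalTime n / optimalTime (n + 1) := by
  rw [optimalThreshold]
  ring

lemma optimalThreshold_cost (n : ℕ) :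
    1 + optimalTime n * -Real.log (1 - optimalThreshold n)
      = optimalThreshold n * optimalTime (n + 1) := by
  have h := optimalTime_equation n
  have h1 : Real.log (1 - optimalThreshold n)
      = -Real.log (optimalTime (n + 1) / optimalTime n) := by
    rw [one_sub_optimalThreshold, ← Real.log_inv, inv_div]
  have h2 : optimalThreshold n * optimalTime (n + 1) = optimalTime (n + 1) - optimalTime n := by
    rw [optimalThreshold]
    field_simp [(optimalTime_succ_pos n).ne']
  rw [h1, h2]
  linarith

/-- The optimal threshold is the unique minimizer of the expected cost of one stage. -/
lemma threshold_cost_gt (n : ℕ) {s : ℝ} (hs1 : s < 1) (hne : s ≠ optimalThreshold n) :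
    s * optimalTime (n + 1) < 1 + optimalTime n * -Real.log (1 - s) := by
  rcases n with _ | n
  · simp [optimalTime_zero, optimalTime_one, hs1]
  have hb := optimalTime_succ_pos n
  have hb' := optimalTime_succ_pos (n + 1)
  have h := optimalTime_equation (n + 1)
  set b := optimalTime (n + 1)
  set b' := optimalTime (n + 1 + 1)
  have hy : 0 < (1 - s) * (b' / b) := mul_pos (by linarith) (div_pos hb' hb)
  -- log z < z - 1 unless z = 1, and z = (1 - s) b' / b equals 1 only at the optimal threshold.
  have hlt := Real.log_lt_sub_one_of_pos hy (fun h1 => hne (by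
    rw [optimalThreshold]
    change s = 1 - b / b'
    field_simp at h1 ⊢
    linarith))
  rw [Real.log_mul (by linarith) (div_pos hb' hb).ne'] at hlt
  have := mul_lt_mul_of_pos_left hlt hb
  have h2 : b * ((1 - s) * (b' / b) - 1) = (1 - s) * b' - b := by
    field_simp
  rw [h2] at this
  linarith

end OptimalSequence

/-! ### Integrals of powers of 1 / (1 - u) over windows. -/

section Integrals

lemma setLIntegral_Icc_of_hasDerivAt {G g : ℝ → ℝ} {x y : ℝ} (hxy : x ≤ y)
    (hG : ∀ u ∈ Icc x y, HasDerivAt G (g u) u) (hg : ContinuousOn g (Icc x y))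
    (h0 : ∀ u ∈ Icc x y, 0 ≤ g u) :
    ∫⁻ u in Icc x y, ENNReal.ofReal (g u) = ENNReal.ofReal (G y - G x) := by
  have hint : IntegrableOn g (Icc x y) := hg.integrableOn_Icc
  rw [← ofReal_integral_eq_lintegral_ofReal hint
    ((ae_restrict_iff' measurableSet_Icc).2 (ae_of_all _ h0)),
    integral_Icc_eq_integral_Ioc, ← intervalIntegral.integral_of_le hxy,
    intervalIntegral.integral_eq_sub_of_hasDerivAt (f := G)]
  · rwa [uIcc_of_le hxy]
  · exact (uIcc_of_le hxy ▸ hg).intervalIntegrable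

lemma hasDerivAt_neg_log_one_sub {u : ℝ} (hu : u < 1) :
    HasDerivAt (fun u => -Real.log (1 - u)) (1 / (1 - u)) u := by
  have := (((hasDerivAt_id u).const_sub 1).log (by simp; linarith)).neg
  exact this.congr_deriv (by simp [neg_div])

lemma hasDerivAt_inv_one_sub {u : ℝ} (hu : u < 1) :
    HasDerivAt (fun u => 1 / (1 - u)) (1 / (1 - u) ^ 2) u := by
  have := ((hasDerivAt_id u).const_sub 1).inv (by simp; linarith)
  simp only [one_div]
  exact this.congr_deriv (by simp)

lemma setLIntegral_Icc_time {a b q x y : ℝ} (ha : 0 ≤ a) (hb : 0 ≤ b) (hq : 0 ≤ q) (hxy : x ≤ y)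
    (hy : y < 1) :
    ∫⁻ u in Icc x y, ENNReal.ofReal (a + b / (1 - u) + q / (1 - u) ^ 2)
      = ENNReal.ofReal (a * (y - x) + b * Real.log ((1 - x) / (1 - y))
        + q * (1 / (1 - y) - 1 / (1 - x))) := by
  have hlt : ∀ u ∈ Icc x y, 0 < 1 - u := fun u hu => by linarith [hu.2]
  rw [setLIntegral_Icc_of_hasDerivAt (G := fun u => a * u + b * -Real.log (1 - u)
    + q * (1 / (1 - u))) hxy ?_ ?_ ?_,
    Real.log_div (by linarith) (by linarith)]
  · congr 1
    ring
  · intro u hu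
    have hu' : u < 1 := by linarith [hlt u hu]
    exact ((((hasDerivAt_id u).const_mul a).add
      ((hasDerivAt_neg_log_one_sub hu').const_mul b)).add
      ((hasDerivAt_inv_one_sub hu').const_mul q)).congr_deriv (by ring)
  · have h1 : ∀ u ∈ Icc x y, 1 - u ≠ 0 := fun u hu => (hlt u hu).ne'
    have h2 : ∀ u ∈ Icc x y, (1 - u) ^ 2 ≠ 0 := fun u hu => pow_ne_zero 2 (h1 u hu)
    fun_prop (disch := assumption)
  · intro u hu
    have := hlt u hu
    positivity

lemma setLIntegral_Icc_div {b x y : ℝ} (hb : 0 ≤ b) (hxy : x ≤ y) (hy : y < 1) :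
    ∫⁻ u in Icc x y, ENNReal.ofReal (b / (1 - u))
      = ENNReal.ofReal (b * Real.log ((1 - x) / (1 - y))) := by
  simpa using setLIntegral_Icc_time le_rfl hb le_rfl hxy hy

lemma setLIntegral_window_div {b s x : ℝ} (hb : 0 ≤ b) (hs : 0 ≤ s) (hs1 : s < 1) (hx : x < 1) :
    ∫⁻ u in window s x, ENNReal.ofReal (b / (1 - u))
      = ENNReal.ofReal (b * -Real.log (1 - s)) := by
  have h : (1 - x) / (1 - (x + s * (1 - x))) = (1 - s)⁻¹ := by
    have h1 : 1 - (x + s * (1 - x)) = (1 - s) * (1 - x) := by ring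
    rw [h1]
    have : 1 - x ≠ 0 := by linarith
    have : 1 - s ≠ 0 := by linarith
    field_simp
  rw [window, setLIntegral_Icc_div hb (by nlinarith) (by nlinarith), h, Real.log_inv]

/-- The windows with s < 1 lie inside this one and their integrals grow like -log (1 - s). So
accepting every larger value while further selections remain costs infinite expected time. -/
lemma setLIntegral_window_one_div {b x : ℝ} (hb : 0 < b) (hx : x < 1) :
    ∫⁻ u in window 1 x, ENNReal.ofReal (b / (1 - u)) = ∞ := by
  have h : Tendsto (fun s : ℝ => ENNReal.ofReal (b * -Real.log (1 - s))) (nhdsWithin 1 (Iio 1))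
      (nhds ∞) := by
    refine ENNReal.tendsto_ofReal_nhds_top.2 (Tendsto.const_mul_atTop hb ?_)
    refine tendsto_neg_atBot_atTop.comp (Real.tendsto_log_nhdsGT_zero.comp ?_)
    refine tendsto_nhdsWithin_of_tendsto_nhds_of_eventually_within _ ?_ ?_
    · have : Tendsto (fun s : ℝ => 1 - s) (nhds 1) (nhds (1 - 1)) :=
        tendsto_const_nhds.sub tendsto_id
      rw [sub_self] at this
      exact this.mono_left nhdsWithin_le_nhds
    · filter_upwards [self_mem_nhdsWithin] with s hs
      have : s < 1 := hs
      exact sub_pos.2 this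
  refine top_le_iff.1 (le_of_tendsto h ?_)
  filter_upwards [self_mem_nhdsWithin, nhdsWithin_le_nhds (lt_mem_nhds zero_lt_one)] with s hs hs0
  have hs' : s < 1 := hs
  rw [← setLIntegral_window_div hb.le hs0.le hs' hx]
  refine lintegral_mono_set (Icc_subset_Icc le_rfl ?_)
  nlinarith

end Integrals

/-! ### The truncated value function as a subsolution. -/

section Subsolution

/-- The minimal expected remaining time from the level `x`, truncated at `C`. -/
noncomputable def truncatedTime (C : ℝ) (j : ℕ) (x : ℝ) : ℝ≥0∞ :=
  ENNReal.ofReal (min (optimalTime j / (1 - x)) C)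

lemma measurable_truncatedTime (C : ℝ) (j : ℕ) : Measurable (truncatedTime C j) :=
  ((measurable_const.div (measurable_const.sub measurable_id)).min measurable_const).ennreal_ofReal

lemma truncatedTime_le (C : ℝ) (j : ℕ) (x : ℝ) : truncatedTime C j x ≤ ENNReal.ofReal C :=
  ENNReal.ofReal_le_ofReal (min_le_right _ _)

lemma truncatedTime_zero (C : ℝ) (hC : 0 ≤ C) (x : ℝ) : truncatedTime C 0 x = 0 := by
  simp [truncatedTime, optimalTime_zero, hC]

/-- The function w - b - b log (w / b) increases for w ≥ b and equals 1 at w = b', by the recursion.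
The comparison uses log z ≤ z - 1 at z = b' / w. -/
lemma gap_le_one (j : ℕ) {w : ℝ} (hw : optimalTime j < w) (hw' : w ≤ optimalTime (j + 1)) :
    w - optimalTime j - optimalTime j * Real.log (w / optimalTime j) ≤ 1 := by
  have h := optimalTime_equation j
  have hb := optimalTime_nonneg j
  set b := optimalTime j
  set b' := optimalTime (j + 1)
  have hw0 : 0 < w := hb.trans_lt hw
  rcases hb.eq_or_lt with hb0 | hb0
  · rw [← hb0] at h ⊢
    linarith
  have h1 := Real.log_le_sub_one_of_pos (div_pos (hw0.trans_le hw') hw0)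
  have h2 : Real.log (b' / b) = Real.log (b' / w) + Real.log (w / b) := by
    rw [← Real.log_mul (div_pos (hw0.trans_le hw') hw0).ne' (div_pos hw0 hb0).ne']
    congr 1
    field_simp
  have h3 : b * Real.log (b' / w) ≤ b' - w := by
    have h4 : 0 ≤ b' / w - 1 := by
      rw [sub_nonneg, one_le_div hw0]
      exact hw'
    calc b * Real.log (b' / w) ≤ b * (b' / w - 1) := by gcongr
      _ ≤ w * (b' / w - 1) := by gcongr
      _ = b' - w := by field_simp
  rw [h2] at h
  linarith

/-- The truncated value function satisfies the optimality equation as an inequality. -/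
lemma truncatedTime_subsolution {C : ℝ} (hC : 0 ≤ C) (j : ℕ) {x : ℝ} (hx : x ∈ Ico (0 : ℝ) 1) :
    truncatedTime C (j + 1) x ≤ 1 + ∫⁻ u in Icc (0 : ℝ) 1,
      if x < u then min (truncatedTime C (j + 1) x) (truncatedTime C j u)
      else truncatedTime C (j + 1) x := by
  have hx1 : 0 < 1 - x := by linarith [hx.2]
  have hbn := optimalTime_nonneg j
  have hb'n := optimalTime_nonneg (j + 1)
  have hgap := gap_le_one j (w := min (optimalTime (j + 1) / (1 - x)) C * (1 - x))
  have hvb : min (optimalTime (j + 1) / (1 - x)) C * (1 - x) ≤ optimalTime (j + 1) := by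
    rw [← le_div_iff₀ hx1]
    exact min_le_left _ _
  have hmin : ∀ u, min (truncatedTime C (j + 1) x) (truncatedTime C j u)
      = ENNReal.ofReal (min (min (optimalTime (j + 1) / (1 - x)) C) (optimalTime j / (1 - u))) := by
    intro u
    rw [truncatedTime, truncatedTime, ← ENNReal.ofReal_min]
    congr 1
    rw [min_comm (optimalTime j / (1 - u)) C, ← min_assoc, min_assoc _ C C, min_self]
  simp only [hmin]
  rw [truncatedTime]
  have hv0 : 0 ≤ min (optimalTime (j + 1) / (1 - x)) C := le_min (by positivity) hC
  set v := min (optimalTime (j + 1) / (1 - x)) C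
  set b := optimalTime j
  set b' := optimalTime (j + 1)
  rcases hv0.eq_or_lt with hv | hv
  · rw [← hv]
    simp
  -- If v (1 - x) ≤ b, then b / (1 - u) ≥ v for all u > x, so the minimum is always v and the
  -- integral alone already reaches v.
  rcases le_or_gt (v * (1 - x)) b with hw | hw
  · refine le_trans ?_ le_add_self
    rw [← restrict_Ico_eq_restrict_Icc]
    calc ENNReal.ofReal v = ∫⁻ _ in Ico (0 : ℝ) 1, ENNReal.ofReal v := by simp
      _ ≤ _ := by
        refine setLIntegral_mono' measurableSet_Ico fun u hu => ?_
        split_ifs with hxu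
        · refine ENNReal.ofReal_le_ofReal (le_min le_rfl ?_)
          rw [le_div_iff₀ (by linarith [hu.2])]
          nlinarith
        · exact le_rfl
  specialize hgap hw hvb
  rcases hbn.eq_or_lt with hb0 | hb0
  · rw [← hb0] at hgap
    have h1 : ENNReal.ofReal (v * x) ≤ ∫⁻ u in Icc (0 : ℝ) 1,
        if x < u then ENNReal.ofReal (min v (b / (1 - u))) else ENNReal.ofReal v := by
      calc ENNReal.ofReal (v * x) = ∫⁻ _ in Icc (0 : ℝ) x, ENNReal.ofReal v := by
            simp [ENNReal.ofReal_mul hv.le]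
        _ ≤ ∫⁻ u in Icc (0 : ℝ) x,
            if x < u then ENNReal.ofReal (min v (b / (1 - u))) else ENNReal.ofReal v := by
          refine setLIntegral_mono' measurableSet_Icc fun u hu => ?_
          rw [if_neg (not_lt.2 hu.2)]
        _ ≤ _ := lintegral_mono_set (Icc_subset_Icc le_rfl hx.2.le)
    refine le_trans ?_ (add_le_add_right h1 1)
    rw [← ENNReal.ofReal_one, ← ENNReal.ofReal_add zero_le_one (mul_nonneg hv.le hx.1)]
    refine ENNReal.ofReal_le_ofReal ?_
    linarith
  -- y is the level with b / (1 - y) = v: for u > x the minimum is b / (1 - u) up to y and v beyond.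
  -- The pieces [0, x), [x, y], (y, 1) contribute at least v x, b log ((1 - x) / (1 - y)) and v (1 -
  -- y) = b, and the required inequality becomes `hgap` with w = v (1 - x).
  obtain ⟨y, hy⟩ : ∃ y, y = 1 - b / v := ⟨_, rfl⟩
  have hbv : 0 < b / v := div_pos hb0 hv
  have hxy : x < y := by
    have : b / v < 1 - x := by
      rw [div_lt_iff₀ hv]
      linarith
    linarith
  have hy1 : y < 1 := by linarith
  have hvy : v * (1 - y) = b := by
    rw [hy]
    field_simp
    ring
  set F : ℝ → ℝ≥0∞ := fun u =>
    if x < u then ENNReal.ofReal (min v (b / (1 - u))) else ENNReal.ofReal v with hF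
  have h1 : ENNReal.ofReal (v * x) ≤ ∫⁻ u in Ico 0 x, F u := by
    calc ENNReal.ofReal (v * x) = ∫⁻ _ in Ico (0 : ℝ) x, ENNReal.ofReal v := by
          simp [ENNReal.ofReal_mul hv.le]
      _ ≤ _ := by
        refine setLIntegral_mono' measurableSet_Ico fun u hu => ?_
        simp only [hF]
        rw [if_neg (not_lt.2 hu.2.le)]
  have h2 : ENNReal.ofReal (b * Real.log ((1 - x) / (1 - y))) ≤ ∫⁻ u in Icc x y, F u := by
    rw [← setLIntegral_Icc_div hb0.le hxy.le hy1]
    refine setLIntegral_mono' measurableSet_Icc fun u hu => ?_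
    have hle : b / (1 - u) ≤ v := by
      rw [div_le_iff₀ (by linarith [hu.2]), ← hvy]
      gcongr
      exact hu.2
    simp only [hF]
    split_ifs
    · exact ENNReal.ofReal_le_ofReal (le_min hle le_rfl)
    · exact ENNReal.ofReal_le_ofReal hle
  have h3 : ENNReal.ofReal b ≤ ∫⁻ u in Ioo y 1, F u := by
    calc ENNReal.ofReal b = ∫⁻ _ in Ioo y 1, ENNReal.ofReal v := by
          rw [setLIntegral_const, Real.volume_Ioo, ← ENNReal.ofReal_mul hv.le, hvy]
      _ ≤ _ := by
        refine setLIntegral_mono' measurableSet_Ioo fun u hu => ?_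
        simp only [hF]
        rw [if_pos (hxy.trans hu.1)]
        refine ENNReal.ofReal_le_ofReal (le_min le_rfl ?_)
        rw [le_div_iff₀ (by linarith [hu.2]), ← hvy]
        gcongr
        exact hu.1.le
  have hlog : 0 ≤ Real.log ((1 - x) / (1 - y)) :=
    Real.log_nonneg ((one_le_div (by linarith)).2 (by linarith))
  have hratio : (1 - x) / (1 - y) = v * (1 - x) / b := by
    rw [← hvy]
    have : 1 - y ≠ 0 := by linarith
    field_simp
  have hsum : ENNReal.ofReal (v * x + b * Real.log ((1 - x) / (1 - y)) + b)
      ≤ ∫⁻ u in Icc 0 1, F u := by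
    rw [ENNReal.ofReal_add (by have := hx.1; positivity) hb0.le,
      ENNReal.ofReal_add (by have := hx.1; positivity) (by positivity)]
    refine (add_le_add (add_le_add h1 h2) h3).trans ?_
    rw [← lintegral_union measurableSet_Icc, ← lintegral_union measurableSet_Ioo]
    · refine lintegral_mono_set ?_
      rintro u ((hu | hu) | hu)
      · exact ⟨hu.1, by linarith [hu.2, hx.2]⟩
      · exact ⟨hx.1.trans hu.1, hu.2.trans hy1.le⟩
      · exact ⟨by linarith [hu.1, hx.1], hu.2.le⟩
    · refine disjoint_left.2 fun u hu hu' => ?_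
      rcases hu with hu | hu
      · linarith [hu.2, hu'.1]
      · linarith [hu.2, hu'.1]
    · exact disjoint_left.2 fun u hu hu' => by linarith [hu.2, hu'.1]
  refine le_trans ?_ (add_le_add_right hsum 1)
  rw [← ENNReal.ofReal_one, ← ENNReal.ofReal_add zero_le_one (by have := hx.1; positivity), hratio]
  refine ENNReal.ofReal_le_ofReal ?_
  linarith

end Subsolution

/-! ### Moments of the geometric distribution. -/

section GeometricSums

lemma hasSum_of_eq {f g : ℕ → ℝ} {a b : ℝ} (h : HasSum f a) (hf : ∀ i, g i = f i) (ha : b = a) :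
    HasSum g b := by
  rw [funext hf, ha]
  exact h

lemma hasSum_geometric_first {p : ℝ} (hp : 0 < p) (hp1 : p ≤ 1) :
    HasSum (fun i : ℕ => (1 - p) ^ i * ((i : ℝ) + 1)) (1 / p ^ 2) := by
  have h := hasSum_choose_mul_geometric_of_norm_lt_one (𝕜 := ℝ) 1 (r := 1 - p)
    (by rw [Real.norm_eq_abs, abs_lt]; constructor <;> linarith)
  rw [sub_sub_cancel] at h
  exact hasSum_of_eq h (fun i => by simp [mul_comm]) rfl

lemma hasSum_geometric_second {p : ℝ} (hp : 0 < p) (hp1 : p ≤ 1) :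
    HasSum (fun i : ℕ => (1 - p) ^ i * (((i : ℝ) + 1) * (i + 2))) (2 / p ^ 3) := by
  have h := (hasSum_choose_mul_geometric_of_norm_lt_one (𝕜 := ℝ) 2 (r := 1 - p)
    (by rw [Real.norm_eq_abs, abs_lt]; constructor <;> linarith)).mul_left 2
  rw [sub_sub_cancel] at h
  refine hasSum_of_eq h (fun i => ?_) (by ring)
  rw [Nat.cast_choose_two]
  push_cast
  ring

lemma hasSum_geometric_zeroth {p : ℝ} (hp : 0 < p) (hp1 : p ≤ 1) :
    HasSum (fun i : ℕ => (1 - p) ^ i) (1 / p) := by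
  have h := hasSum_geometric_of_lt_one (r := 1 - p) (by linarith) (by linarith)
  rwa [sub_sub_cancel, ← one_div] at h

lemma tsum_ofReal_pow_mul {p S : ℝ} (hp1 : p ≤ 1) {c : ℕ → ℝ} (hc : ∀ i, 0 ≤ c i)
    (h : HasSum (fun i => (1 - p) ^ i * c i) S) :
    ∑' i, ENNReal.ofReal (1 - p) ^ i * ENNReal.ofReal (c i) = ENNReal.ofReal S := by
  have h0 : ∀ i, 0 ≤ (1 - p) ^ i := fun i => pow_nonneg (by linarith) i
  rw [← h.tsum_eq, ENNReal.ofReal_tsum_of_nonneg (fun i => mul_nonneg (h0 i) (hc i)) h.summable]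
  refine tsum_congr fun i => ?_
  rw [ENNReal.ofReal_mul (h0 i), ENNReal.ofReal_pow (by linarith)]

lemma tsum_geometric_time {p : ℝ} (hp : 0 < p) (hp1 : p ≤ 1) (m : ℕ) (I : ℝ≥0∞) :
    ∑' i : ℕ, ENNReal.ofReal (1 - p) ^ i * (((m + i + 1 : ℕ) : ℝ≥0∞) * ENNReal.ofReal p + I)
      = m + (ENNReal.ofReal p)⁻¹ * (1 + I) := by
  have h0 : ∑' i : ℕ, ENNReal.ofReal (1 - p) ^ i = (ENNReal.ofReal p)⁻¹ := by
    rw [ENNReal.tsum_geometric, ← ENNReal.ofReal_one, ← ENNReal.ofReal_sub _ (by linarith),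
      sub_sub_cancel]
  have h1 : ∑' i : ℕ, ENNReal.ofReal (1 - p) ^ i * (((m + i + 1 : ℕ) : ℝ≥0∞) * ENNReal.ofReal p)
      = m + (ENNReal.ofReal p)⁻¹ := by
    have h2 : HasSum (fun i : ℕ => (1 - p) ^ i * (((m + i + 1 : ℕ) : ℝ) * p)) (m + 1 / p) := by
      have h3 := ((hasSum_geometric_zeroth hp hp1).mul_left (m * p)).add
        ((hasSum_geometric_first hp hp1).mul_left p)
      refine hasSum_of_eq h3 (fun i => ?_) (by field_simp)
      push_cast
      ring
    have h4 := tsum_ofReal_pow_mul hp1 (fun i => by positivity) h2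
    rw [ENNReal.ofReal_add (by positivity) (by positivity), ENNReal.ofReal_natCast, one_div,
      ENNReal.ofReal_inv_of_pos hp] at h4
    rw [← h4]
    refine tsum_congr fun i => ?_
    rw [ENNReal.ofReal_mul (by positivity), ENNReal.ofReal_natCast]
  simp only [mul_add]
  rw [ENNReal.tsum_add, h1, ENNReal.tsum_mul_right, h0, mul_one, add_assoc]

end GeometricSums

/-! ### The potential across one threshold stage. -/

section Stage

variable {Ω : Type*} [mΩ : MeasurableSpace Ω] {μ : Measure Ω} [IsProbabilityMeasure μ]
  {X : ℕ → Ω → ℝ} {σ : Ω → ℕ∞}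

lemma toENNReal_eq_toNat {a : ℕ∞} (h : a < ⊤) : (a : ℝ≥0∞) = (a.toNat : ℝ≥0∞) := by
  obtain ⟨n, rfl⟩ := ENat.ne_top_iff_exists.1 h.ne
  simp

lemma IsUniformSequence.ae_stoppedValue_mem (hX : IsUniformSequence X μ) (σ : Ω → ℕ∞) :
    ∀ᵐ ω ∂μ, stoppedValue X σ ω ∈ Ico (0 : ℝ) 1 := by
  filter_upwards [hX.ae_mem_Ico] with ω hω using hω _

lemma IsUniformSequence.ae_nextTime_lt_top (hX : IsUniformSequence X μ)
    (hσ : IsStoppingTime hX.filtration σ) (hfin : ∀ᵐ ω ∂μ, σ ω < ⊤) {s : ℝ}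
    (hs : s ∈ Icc (0 : ℝ) 1) (hs0 : 0 < s) : ∀ᵐ ω ∂μ, nextTime X s σ ω < ⊤ := by
  have h := hX.lintegral_nextTime hσ hfin hs (f := fun _ _ => 1) (fun _ => measurable_const)
  have h1 : ∫⁻ ω, ∑' i : ℕ, ENNReal.ofReal (1 - s * (1 - stoppedValue X σ ω)) ^ i *
      ∫⁻ _ in window s (stoppedValue X σ ω), 1 ∂volume ∂μ = ∫⁻ _, 1 ∂μ := by
    refine lintegral_congr_ae ?_
    filter_upwards [hX.ae_stoppedValue_mem σ] with ω hω
    have hp : 0 < s * (1 - stoppedValue X σ ω) := mul_pos hs0 (by linarith [hω.2])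
    have hp1 : s * (1 - stoppedValue X σ ω) ≤ 1 := by nlinarith [hω.1, hω.2, hs.1, hs.2]
    rw [setLIntegral_one, volume_window, ENNReal.tsum_mul_right, ENNReal.tsum_geometric,
      ← ENNReal.ofReal_one, ← ENNReal.ofReal_sub _ (by linarith), sub_sub_cancel]
    rw [ENNReal.inv_mul_cancel (by simpa using hp) ENNReal.ofReal_ne_top, ENNReal.ofReal_one]
  rw [h1, setLIntegral_one, lintegral_one, measure_univ] at h
  exact (prob_compl_eq_zero_iff
    (stopping_measurable_comp (hX.isStoppingTime_nextTime hσ s) (fun a : ℕ∞ => a < ⊤)).setOf).2 h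

lemma IsUniformSequence.lintegral_nextTime_of_pos (hX : IsUniformSequence X μ)
    (hσ : IsStoppingTime hX.filtration σ) (hfin : ∀ᵐ ω ∂μ, σ ω < ⊤) {s : ℝ}
    (hs : s ∈ Icc (0 : ℝ) 1) (hs0 : 0 < s) {f : ℕ → ℝ → ℝ≥0∞} (hf : ∀ n, Measurable (f n)) :
    ∫⁻ ω, f (nextTime X s σ ω).toNat (stoppedValue X (nextTime X s σ) ω) ∂μ
      = ∫⁻ ω, ∑' i : ℕ, ENNReal.ofReal (1 - s * (1 - stoppedValue X σ ω)) ^ i *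
          ∫⁻ u in window s (stoppedValue X σ ω), f ((σ ω).toNat + i + 1) u ∂volume ∂μ := by
  rw [← hX.lintegral_nextTime hσ hfin hs hf, Measure.restrict_eq_self_of_ae_mem
    (s := {ω | nextTime X s σ ω < ⊤}) (hX.ae_nextTime_lt_top hσ hfin hs hs0)]

/-- The window of threshold 0 is a single point, which is almost surely never hit; this excludes
zero parameters in the uniqueness proof. -/
lemma IsUniformSequence.ae_nextTime_zero (hX : IsUniformSequence X μ)
    (hσ : IsStoppingTime hX.filtration σ) (hfin : ∀ᵐ ω ∂μ, σ ω < ⊤) :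
    ∀ᵐ ω ∂μ, ¬ nextTime X 0 σ ω < ⊤ := by
  have h := hX.lintegral_nextTime hσ hfin (s := 0) ⟨le_rfl, zero_le_one⟩
    (f := fun _ _ => 1) (fun _ => measurable_const)
  simp only [setLIntegral_one, volume_window, zero_mul, ENNReal.ofReal_zero, mul_zero,
    tsum_zero, lintegral_zero] at h
  exact measure_eq_zero_iff_ae_notMem.1 h

/-- The expected value of `σ` plus the minimal expected time for `j` further selections. -/
noncomputable def potential (μ : Measure Ω) (X : ℕ → Ω → ℝ) (j : ℕ) (σ : Ω → ℕ∞) : ℝ≥0∞ :=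
  ∫⁻ ω, ((σ ω : ℝ≥0∞) + ENNReal.ofReal (optimalTime j / (1 - stoppedValue X σ ω))) ∂μ

/-- The expected time added by a stage with threshold `s`, followed by `j` optimal stages. -/
noncomputable def stageTime (j : ℕ) (s x : ℝ) : ℝ≥0∞ :=
  (ENNReal.ofReal (s * (1 - x)))⁻¹ *
    (1 + ∫⁻ u in window s x, ENNReal.ofReal (optimalTime j / (1 - u)))

lemma IsUniformSequence.potential_nextTime (hX : IsUniformSequence X μ)
    (hσ : IsStoppingTime hX.filtration σ) (hfin : ∀ᵐ ω ∂μ, σ ω < ⊤) {s : ℝ}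
    (hs : s ∈ Icc (0 : ℝ) 1) (hs0 : 0 < s) (j : ℕ) :
    potential μ X j (nextTime X s σ)
      = ∫⁻ ω, ((σ ω : ℝ≥0∞) + stageTime j s (stoppedValue X σ ω)) ∂μ := by
  have hfin' := hX.ae_nextTime_lt_top hσ hfin hs hs0
  have hmeas : Measurable fun u : ℝ => ENNReal.ofReal (optimalTime j / (1 - u)) := by fun_prop
  have h := hX.lintegral_nextTime_of_pos hσ hfin hs hs0
    (f := fun n u => (n : ℝ≥0∞) + ENNReal.ofReal (optimalTime j / (1 - u)))
    (fun n => hmeas.const_add _)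
  rw [potential]
  calc _ = _ := by
        refine lintegral_congr_ae ?_
        filter_upwards [hfin'] with ω hω
        rw [toENNReal_eq_toNat hω]
    _ = _ := h
    _ = _ := by
        refine lintegral_congr_ae ?_
        filter_upwards [hfin, hX.ae_stoppedValue_mem σ] with ω h1 hω
        have hp : 0 < s * (1 - stoppedValue X σ ω) := mul_pos hs0 (by linarith [hω.2])
        have hp1 : s * (1 - stoppedValue X σ ω) ≤ 1 := by nlinarith [hω.1, hω.2, hs.1, hs.2]
        simp only [lintegral_add_left measurable_const, setLIntegral_const, volume_window]
        rw [tsum_geometric_time hp hp1, stageTime, toENNReal_eq_toNat h1]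

lemma stageTime_of_lt_one (j : ℕ) {s x : ℝ} (hs0 : 0 < s) (hs1 : s < 1) (hx : x < 1) :
    stageTime j s x
      = ENNReal.ofReal ((1 + optimalTime j * -Real.log (1 - s)) / (s * (1 - x))) := by
  have hlog : 0 ≤ -Real.log (1 - s) := by
    have := Real.log_nonpos (by linarith : 0 ≤ 1 - s) (by linarith)
    linarith
  have hp : 0 < s * (1 - x) := mul_pos hs0 (by linarith)
  rw [stageTime, setLIntegral_window_div (optimalTime_nonneg j) hs0.le hs1 hx,
    ← ENNReal.ofReal_one, ← ENNReal.ofReal_add zero_le_one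
      (mul_nonneg (optimalTime_nonneg j) hlog), ENNReal.ofReal_div_of_pos hp,
    ENNReal.div_eq_inv_mul]

lemma stageTime_optimal (j : ℕ) {x : ℝ} (hx : x < 1) :
    stageTime j (optimalThreshold j) x = ENNReal.ofReal (optimalTime (j + 1) / (1 - x)) := by
  rcases j with _ | j
  · have : 0 < 1 - x := by linarith
    simp [stageTime, optimalTime_zero, optimalTime_one, optimalThreshold_zero,
      ENNReal.ofReal_inv_of_pos this]
  · rw [stageTime_of_lt_one _ (optimalThreshold_pos _) (optimalThreshold_succ_lt_one j) hx,
      optimalThreshold_cost, mul_div_mul_left _ _ (optimalThreshold_pos _).ne']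

/-- For s < 1 this is `threshold_cost_gt` divided by s (1 - x). For s = 1 the stage time is infinite
unless j = 0, and then 1 is itself the optimal threshold. -/
lemma lt_stageTime (j : ℕ) {s x : ℝ} (hs : s ∈ Icc (0 : ℝ) 1) (hs0 : 0 < s)
    (hne : s ≠ optimalThreshold j) (hx : x < 1) :
    ENNReal.ofReal (optimalTime (j + 1) / (1 - x)) < stageTime j s x := by
  have hx1 : 0 < 1 - x := by linarith
  rcases hs.2.lt_or_eq with hs1 | rfl
  · rw [stageTime_of_lt_one j hs0 hs1 hx]
    have h := threshold_cost_gt j hs1 hne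
    have hb := optimalTime_succ_pos j
    rw [ENNReal.ofReal_lt_ofReal_iff_of_nonneg (by positivity), div_lt_div_iff₀ hx1 (by positivity)]
    nlinarith
  · rcases j with _ | j
    · exact absurd optimalThreshold_zero.symm hne
    · rw [stageTime, setLIntegral_window_one_div (optimalTime_succ_pos j) hx, add_top,
        ENNReal.mul_top (by simp)]
      exact ENNReal.ofReal_lt_top

lemma IsUniformSequence.potential_optimal (hX : IsUniformSequence X μ)
    (hσ : IsStoppingTime hX.filtration σ) (hfin : ∀ᵐ ω ∂μ, σ ω < ⊤) (j : ℕ) :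
    potential μ X j (nextTime X (optimalThreshold j) σ) = potential μ X (j + 1) σ := by
  rw [hX.potential_nextTime hσ hfin (optimalThreshold_mem j) (optimalThreshold_pos j), potential]
  refine lintegral_congr_ae ?_
  filter_upwards [hX.ae_stoppedValue_mem σ] with ω hω
  rw [stageTime_optimal j hω.2]

lemma IsUniformSequence.potential_le (hX : IsUniformSequence X μ)
    (hσ : IsStoppingTime hX.filtration σ) (hfin : ∀ᵐ ω ∂μ, σ ω < ⊤) {s : ℝ}
    (hs : s ∈ Icc (0 : ℝ) 1) (hs0 : 0 < s) (j : ℕ) :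
    potential μ X (j + 1) σ ≤ potential μ X j (nextTime X s σ) := by
  by_cases hne : s = optimalThreshold j
  · rw [hne, hX.potential_optimal hσ hfin]
  rw [hX.potential_nextTime hσ hfin hs hs0, potential]
  refine lintegral_mono_ae ?_
  filter_upwards [hX.ae_stoppedValue_mem σ] with ω hω
  gcongr
  exact (lt_stageTime j hs hs0 hne hω.2).le

lemma IsUniformSequence.potential_lt (hX : IsUniformSequence X μ)
    (hσ : IsStoppingTime hX.filtration σ) (hfin : ∀ᵐ ω ∂μ, σ ω < ⊤) {s : ℝ}
    (hs : s ∈ Icc (0 : ℝ) 1) (hs0 : 0 < s) (j : ℕ) (hne : s ≠ optimalThreshold j)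
    (htop : potential μ X (j + 1) σ ≠ ∞) :
    potential μ X (j + 1) σ < potential μ X j (nextTime X s σ) := by
  refine lt_of_le_of_ne (hX.potential_le hσ hfin hs hs0 j) fun heq => ?_
  rw [hX.potential_nextTime hσ hfin hs hs0, potential] at heq
  have hle : (fun ω => (σ ω : ℝ≥0∞)
      + ENNReal.ofReal (optimalTime (j + 1) / (1 - stoppedValue X σ ω)))
      ≤ᵐ[μ] fun ω => (σ ω : ℝ≥0∞) + stageTime j s (stoppedValue X σ ω) := by
    filter_upwards [hX.ae_stoppedValue_mem σ] with ω hω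
    gcongr
    exact (lt_stageTime j hs hs0 hne hω.2).le
  have hms : AEMeasurable (fun ω => (σ ω : ℝ≥0∞) + stageTime j s (stoppedValue X σ ω)) μ := by
    have h1 : Measurable (stageTime j s) :=
      (((measurable_id.const_sub 1).const_mul s).ennreal_ofReal.inv).mul
        ((measurable_setLIntegral_window s (by fun_prop)).const_add 1)
    exact ((stopping_measurable_lintegrand hσ).add
      (h1.comp (stopping_measurable_stoppedValue hσ hX.measurable))).aemeasurable
  -- Ordered integrands with equal finite integrals agree almost everywhere, against the pointwise
  -- strict inequality.
  have := ae_eq_of_ae_le_of_lintegral_le hle htop hms heq.ge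
  have hfalse : ∀ᵐ ω ∂μ, False := by
    filter_upwards [this, hfin, hX.ae_stoppedValue_mem σ] with ω h1 h2 h3
    have h4 : (σ ω : ℝ≥0∞) ≠ ∞ := by simpa using h2.ne
    exact (lt_stageTime j hs hs0 hne h3.2).ne ((ENNReal.add_right_inj h4).1 h1)
  simp [IsProbabilityMeasure.ne_zero] at hfalse

end Stage

/-! ### The second moment of the optimal time. -/

section SecondMoment

/-- The expectation of `T (T + 1)`, where `T` is the time of `n` optimal selections. -/
noncomputable def secondMoment (n : ℕ) : ℝ :=
  optimalTime n * ∑ i ∈ Finset.range n, 2 / optimalThreshold i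

lemma secondMoment_nonneg (n : ℕ) : 0 ≤ secondMoment n :=
  mul_nonneg (optimalTime_nonneg n) (Finset.sum_nonneg fun i _ =>
    (div_pos two_pos (optimalThreshold_pos i)).le)

/-- The expectation of `T (T + 1)` for the total time `T`, when `j` optimal selections remain at
time `m` and level `x`. -/
noncomputable def quadraticTime (j m : ℕ) (x : ℝ) : ℝ :=
  ((m : ℝ) ^ 2 + m) + 2 * m * optimalTime j / (1 - x) + secondMoment j / (1 - x) ^ 2

/-- The logarithm from b / (1 - u) is eliminated by the optimality equation, as b (-log (1 - s)) = s
b' - 1, and the term in 1 / (1 - u)² uses 1 - s = b / b'. The case j = 0 is separate because there 1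
- s = 0. -/
lemma setLIntegral_window_quadraticTime (j n : ℕ) {x : ℝ} (hx : x < 1) :
    ∫⁻ u in window (optimalThreshold j) x, ENNReal.ofReal (quadraticTime j n u)
      = ENNReal.ofReal (((n : ℝ) ^ 2 + n) * (optimalThreshold j * (1 - x))
        + 2 * n * (optimalThreshold j * optimalTime (j + 1) - 1)
        + (optimalTime (j + 1) * ∑ i ∈ Finset.range j, 2 / optimalThreshold i - secondMoment j)
          / (1 - x)) := by
  have hx1 : 0 < 1 - x := by linarith
  rcases j with _ | j
  · simp only [quadraticTime, secondMoment, optimalTime_zero, optimalThreshold_zero,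
      zero_add, optimalTime_one]
    simp [volume_window, ENNReal.ofReal_mul (by positivity : (0 : ℝ) ≤ (n : ℝ) ^ 2 + n)]
  · have hs0 := optimalThreshold_pos (j + 1)
    have hs1 := optimalThreshold_succ_lt_one j
    have hcost := optimalThreshold_cost (j + 1)
    have hone := one_sub_optimalThreshold (j + 1)
    have hb := optimalTime_succ_pos j
    have hb' := optimalTime_succ_pos (j + 1)
    simp only [quadraticTime]
    rw [window, setLIntegral_Icc_time (by positivity)
      (mul_nonneg (by positivity) (optimalTime_nonneg _)) (secondMoment_nonneg _)
      (by nlinarith) (by nlinarith)]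
    have h1 : 1 - (x + optimalThreshold (j + 1) * (1 - x))
        = (1 - optimalThreshold (j + 1)) * (1 - x) := by ring
    have h2 : (1 - x) / ((1 - optimalThreshold (j + 1)) * (1 - x))
        = (1 - optimalThreshold (j + 1))⁻¹ := by
      have : 1 - optimalThreshold (j + 1) ≠ 0 := by linarith
      field_simp
    have h3 : secondMoment (j + 1) * (1 / ((1 - optimalThreshold (j + 1)) * (1 - x)) - 1 / (1 - x))
        = (optimalTime (j + 1 + 1) * ∑ i ∈ Finset.range (j + 1), 2 / optimalThreshold i
          - secondMoment (j + 1)) / (1 - x) := by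
      rw [hone, secondMoment]
      field_simp
    rw [h1, h3, h2, Real.log_inv, ← hcost]
    congr 1
    ring

lemma tsum_quadraticTime (j m : ℕ) {x : ℝ} (hx : x ∈ Ico (0 : ℝ) 1) :
    ∑' i : ℕ, ENNReal.ofReal (1 - optimalThreshold j * (1 - x)) ^ i *
        ∫⁻ u in window (optimalThreshold j) x, ENNReal.ofReal (quadraticTime j (m + i + 1) u)
      = ENNReal.ofReal (quadraticTime (j + 1) m x) := by
  have hx1 : 0 < 1 - x := by linarith [hx.2]
  have hs0 := optimalThreshold_pos j
  have hs1 := (optimalThreshold_mem j).2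
  have hp : 0 < optimalThreshold j * (1 - x) := mul_pos hs0 hx1
  have hp1 : optimalThreshold j * (1 - x) ≤ 1 := by nlinarith [hx.1]
  have hone := one_sub_optimalThreshold j
  have hb' := optimalTime_succ_pos j
  have hS : 0 ≤ ∑ i ∈ Finset.range j, 2 / optimalThreshold i :=
    Finset.sum_nonneg fun i _ => (div_pos two_pos (optimalThreshold_pos i)).le
  have hB : 0 ≤ optimalThreshold j * optimalTime (j + 1) - 1 := by
    have h2 := optimalThreshold_cost j
    have h3 : 0 ≤ -Real.log (1 - optimalThreshold j) := by
      have := Real.log_nonpos (by linarith : 0 ≤ 1 - optimalThreshold j) (by linarith)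
      linarith
    have := mul_nonneg (optimalTime_nonneg j) h3
    linarith
  have hQ : optimalTime (j + 1) * ∑ i ∈ Finset.range j, 2 / optimalThreshold i - secondMoment j
      = optimalThreshold j * optimalTime (j + 1) * ∑ i ∈ Finset.range j, 2 / optimalThreshold i := by
    rw [secondMoment, optimalThreshold]
    field_simp
  simp only [setLIntegral_window_quadraticTime j _ hx.2, hQ]
  rw [tsum_ofReal_pow_mul (S := quadraticTime (j + 1) m x) hp1 (fun i => by positivity)]
  set s := optimalThreshold j
  set S := ∑ i ∈ Finset.range j, 2 / optimalThreshold i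
  set B := s * optimalTime (j + 1) - 1 with hBdef
  set p := s * (1 - x) with hpdef
  -- With k = i + 1, (m + k)(m + k + 1) = m (m + 1) + 2 m k + k (k + 1), so the summand is a
  -- combination of 1, k and k (k + 1), and their geometric sums are known.
  have h := (((hasSum_geometric_zeroth hp hp1).mul_left
      (((m : ℝ) ^ 2 + m) * p + 2 * m * B + s * optimalTime (j + 1) * S / (1 - x))).add
    ((hasSum_geometric_first hp hp1).mul_left (2 * m * p + 2 * B))).add
    ((hasSum_geometric_second hp hp1).mul_left p)
  refine hasSum_of_eq h (fun i => ?_) ?_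
  · push_cast
    ring
  · rw [quadraticTime, secondMoment, Finset.sum_range_succ, hBdef, hpdef]
    change (m : ℝ) ^ 2 + m + 2 * m * optimalTime (j + 1) / (1 - x)
      + optimalTime (j + 1) * (S + 2 / s) / (1 - x) ^ 2 = _
    field_simp
    ring

variable {Ω : Type*} [mΩ : MeasurableSpace Ω] {μ : Measure Ω} [IsProbabilityMeasure μ]
  {X : ℕ → Ω → ℝ} {σ : Ω → ℕ∞}

lemma IsUniformSequence.lintegral_quadraticTime (hX : IsUniformSequence X μ)
    (hσ : IsStoppingTime hX.filtration σ) (hfin : ∀ᵐ ω ∂μ, σ ω < ⊤) (j : ℕ) :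
    ∫⁻ ω, ENNReal.ofReal (quadraticTime j (nextTime X (optimalThreshold j) σ ω).toNat
        (stoppedValue X (nextTime X (optimalThreshold j) σ) ω)) ∂μ
      = ∫⁻ ω, ENNReal.ofReal (quadraticTime (j + 1) (σ ω).toNat (stoppedValue X σ ω)) ∂μ := by
  rw [hX.lintegral_nextTime_of_pos hσ hfin (optimalThreshold_mem j) (optimalThreshold_pos j)
    (f := fun n u => ENNReal.ofReal (quadraticTime j n u))
    (fun n => by unfold quadraticTime; fun_prop)]
  refine lintegral_congr_ae ?_
  filter_upwards [hX.ae_stoppedValue_mem σ] with ω hω using tsum_quadraticTime j _ hω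

end SecondMoment

/-! ### Optimality and uniqueness of the threshold policy. -/

section Policies

variable {Ω : Type*} {X : ℕ → Ω → ℝ} {n : ℕ}

lemma thresholdPolicy_succ (t : Fin n → ℝ) (k : Fin n) :
    thresholdPolicy X t k.succ = nextTime X (t k.rev) (thresholdPolicy X t k.castSucc) :=
  Fin.induction_succ (motive := fun _ => Ω → ℕ∞) (fun _ => 0)
    (fun k τk => nextTime X (t k.rev) τk) k

lemma stoppedValue_nextTime_mem {s : ℝ} {σ : Ω → ℕ∞} {ω : Ω} (h : nextTime X s σ ω < ⊤) :
    stoppedValue X (nextTime X s σ) ω ∈ window s (stoppedValue X σ ω) := by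
  obtain ⟨m, hm⟩ := ENat.ne_top_iff_exists.1 h.ne
  obtain ⟨i, hi, hlt, hw⟩ := (nextTime_le_iff m).1 hm.symm.le
  have h2 : nextTime X s σ ω ≤ i := (nextTime_le_iff i).2 ⟨i, le_rfl, hlt, hw⟩
  rw [← hm] at h2
  have : m ≤ i := by exact_mod_cast h2
  obtain rfl : i = m := le_antisymm hi this
  rwa [stoppedValue_of_eq hm.symm]

variable [mΩ : MeasurableSpace Ω] {μ : Measure Ω}

lemma potential_last {σ : Ω → ℕ∞} : potential μ X 0 σ = ∫⁻ ω, (σ ω : ℝ≥0∞) ∂μ := by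
  simp [potential, optimalTime_zero]

lemma IsUniformSequence.isStoppingTime_thresholdPolicy (hX : IsUniformSequence X μ)
    (t : Fin n → ℝ) (k : Fin (n + 1)) :
    IsStoppingTime hX.filtration (thresholdPolicy X t k) := by
  induction k using Fin.induction with
  | zero => exact isStoppingTime_const _ 0
  | succ k ih =>
    rw [thresholdPolicy_succ]
    exact hX.isStoppingTime_nextTime ih _

lemma IsPolicy.ae_forall_lt_top {hX : IsUniformSequence X μ} {τ : Fin (n + 1) → Ω → ℕ∞}
    (hτ : IsPolicy hX n τ) : ∀ᵐ ω ∂μ, ∀ k, τ k ω < ⊤ := by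
  have h1 := ae_lt_top (stopping_measurable_lintegrand (hτ.stopping (Fin.last n)))
    hτ.finite.ne
  filter_upwards [h1, hτ.times_lt] with ω h2 h3 k
  refine (h3.monotone (Fin.le_last k)).trans_lt ?_
  simpa [lt_top_iff_ne_top] using h2

variable [IsProbabilityMeasure μ]

lemma IsUniformSequence.ae_thresholdPolicy_lt_top (hX : IsUniformSequence X μ) {t : Fin n → ℝ}
    (ht : ∀ i, t i ∈ Icc (0 : ℝ) 1) (ht0 : ∀ i, 0 < t i) (k : Fin (n + 1)) :
    ∀ᵐ ω ∂μ, thresholdPolicy X t k ω < ⊤ := by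
  induction k using Fin.induction with
  | zero => exact ae_of_all _ fun ω => ENat.natCast_lt_top 0
  | succ k ih =>
    rw [thresholdPolicy_succ]
    exact hX.ae_nextTime_lt_top (hX.isStoppingTime_thresholdPolicy t _) ih (ht _) (ht0 _)

lemma IsUniformSequence.isPolicy_thresholdPolicy (hX : IsUniformSequence X μ) {t : Fin n → ℝ}
    (ht : ∀ i, t i ∈ Icc (0 : ℝ) 1) (ht0 : ∀ i, 0 < t i)
    (hfin : expectedTime μ (thresholdPolicy X t) < ∞) :
    IsPolicy hX n (thresholdPolicy X t) := by
  have htop : ∀ᵐ ω ∂μ, ∀ k, thresholdPolicy X t k ω < ⊤ :=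
    ae_all_iff.2 (hX.ae_thresholdPolicy_lt_top ht ht0)
  refine ⟨fun ω => rfl, hX.isStoppingTime_thresholdPolicy t, ?_, ?_, hfin⟩
  · filter_upwards [htop] with ω hω
    refine Fin.strictMono_iff_lt_succ.2 fun k => ?_
    rw [thresholdPolicy_succ]
    exact lt_nextTime (hω _)
  · filter_upwards [htop, hX.ae_injective] with ω hω hinj
    have hmono : StrictMono fun k => stoppedValue X (thresholdPolicy X t k) ω := by
      refine Fin.strictMono_iff_lt_succ.2 fun k => ?_
      have h1 := hω k.succ
      have h2 := lt_nextTime (X := X) (s := t k.rev) (hω k.castSucc)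
      rw [thresholdPolicy_succ] at h1 ⊢
      refine lt_of_le_of_ne (stoppedValue_nextTime_mem h1).1 ?_
      obtain ⟨a, ha⟩ := ENat.ne_top_iff_exists.1 h1.ne
      obtain ⟨b, hb⟩ := ENat.ne_top_iff_exists.1 (hω k.castSucc).ne
      rw [← ha, ← hb] at h2
      rw [stoppedValue_of_eq ha.symm, stoppedValue_of_eq hb.symm]
      exact hinj b a (by exact_mod_cast h2)
    intro j k _ hjk
    exact hmono hjk

lemma potential_zero_eq {j : ℕ} {σ : Ω → ℕ∞} (hX : IsUniformSequence X μ) (h : ∀ ω, σ ω = 0) :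
    potential μ X j σ = ENNReal.ofReal (optimalTime j) := by
  have h1 : ∀ ω, stoppedValue X σ ω = 0 := fun ω => by
    rw [stoppedValue_of_eq (m := 0) (by rw [h]; rfl), hX.zero]
  simp [potential, h, h1]

/-- The optimal thresholds for `n` selections. -/
noncomputable def optimalThresholds (n : ℕ) : Fin n → ℝ := fun i => optimalThreshold i

lemma IsUniformSequence.expectedTime_optimal (hX : IsUniformSequence X μ) (n : ℕ) :
    expectedTime μ (thresholdPolicy X (optimalThresholds n))
      = ENNReal.ofReal (optimalTime n) := by
  have h : ∀ k : Fin (n + 1), potential μ X (n - k) (thresholdPolicy X (optimalThresholds n) k)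
      = ENNReal.ofReal (optimalTime n) := by
    intro k
    induction k using Fin.induction with
    | zero => exact potential_zero_eq hX fun _ => rfl
    | succ k ih =>
      rw [thresholdPolicy_succ, ← ih]
      have h1 : optimalThresholds n k.rev = optimalThreshold (n - (k.succ : Fin (n + 1))) := by
        simp [optimalThresholds, Fin.val_rev]
      have h2 : n - (k.castSucc : Fin (n + 1)) = n - (k.succ : Fin (n + 1)) + 1 := by
        have := k.isLt
        simp only [Fin.val_castSucc, Fin.val_succ]
        omega
      rw [h1, h2]
      exact hX.potential_optimal (hX.isStoppingTime_thresholdPolicy _ _)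
        (hX.ae_thresholdPolicy_lt_top (fun i => optimalThreshold_mem i)
          (fun i => optimalThreshold_pos i) _) _
  have := h (Fin.last n)
  rwa [Fin.val_last, Nat.sub_self, potential_last] at this

/-- No policy is faster than the optimal threshold policy. -/
lemma IsPolicy.optimalTime_le {hX : IsUniformSequence X μ} {τ : Fin (n + 1) → Ω → ℕ∞}
    (hτ : IsPolicy hX n τ) : ENNReal.ofReal (optimalTime n) ≤ expectedTime μ τ := by
  have hC := optimalTime_nonneg n
  -- Truncation at C = b_n leaves the value at level 0 unchanged, so the bound obtained at the start
  -- is b_n itself.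
  have hstage : Monotone fun k : Fin (n + 1) => ∫⁻ ω, (τ k ω : ℝ≥0∞) ∂μ
      + ∫⁻ ω, truncatedTime (optimalTime n) (n - k) (stoppedValue X (τ k) ω) ∂μ := by
    refine Fin.monotone_iff_le_succ.2 fun k => ?_
    have h2 : n - (k.castSucc : Fin (n + 1)) = n - (k.succ : Fin (n + 1)) + 1 := by
      have := k.isLt
      simp only [Fin.val_castSucc, Fin.val_succ]
      omega
    have hlt : ∀ᵐ ω ∂μ, τ k.castSucc ω < τ k.succ ω := by
      filter_upwards [hτ.times_lt] with ω h using h k.castSucc_lt_succ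
    have hval : ∀ᵐ ω ∂μ, stoppedValue X (τ k.castSucc) ω < stoppedValue X (τ k.succ) ω := by
      -- `values_lt` compares only genuine selections; the starting value 0 lies strictly below the
      -- first one because ties are null.
      rcases eq_or_ne k.castSucc 0 with h0 | h0
      · filter_upwards [hτ.ae_forall_lt_top, hlt, hX.ae_mem_Ico, hX.ae_injective] with ω h1 h3 h4 h5
        obtain ⟨a, ha⟩ := ENat.ne_top_iff_exists.1 (h1 k.succ).ne
        rw [h0, hτ.start, ← ha] at h3
        have ha0 : 0 < a := by exact_mod_cast h3
        rw [h0, stoppedValue_of_eq (m := 0) (hτ.start ω), stoppedValue_of_eq ha.symm]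
        have h6 := h5 0 a ha0
        rw [hX.zero] at h6 ⊢
        exact lt_of_le_of_ne (h4 a).1 h6
      · filter_upwards [hτ.values_lt] with ω h
        exact h _ _ (Fin.pos_iff_ne_zero.2 h0) k.castSucc_lt_succ
    have := hX.verification_stage (hτ.stopping k.castSucc) (hτ.stopping k.succ) hlt
      (hτ.ae_forall_lt_top.mono fun ω h => h _) hval
      (measurable_truncatedTime (optimalTime n) (n - (k.succ : Fin (n + 1)) + 1))
      (measurable_truncatedTime (optimalTime n) (n - (k.succ : Fin (n + 1))))
      ENNReal.ofReal_ne_top (truncatedTime_le _ _)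
      (fun x hx => truncatedTime_subsolution hC _ hx)
    simpa only [h2] using this
  have h := hstage (Fin.zero_le (Fin.last n))
  have h0 : ∀ ω, stoppedValue X (τ 0) ω = 0 := fun ω => by
    rw [stoppedValue_of_eq (m := 0) (hτ.start ω), hX.zero]
  simpa [hτ.start, h0, truncatedTime_zero _ hC, truncatedTime, optimalTime_zero, hC, expectedTime,
    completionTime] using h

lemma IsUniformSequence.isPolicy_optimal (hX : IsUniformSequence X μ) (n : ℕ) :
    IsPolicy hX n (thresholdPolicy X (optimalThresholds n)) := by
  refine hX.isPolicy_thresholdPolicy (fun i => optimalThreshold_mem i)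
    (fun i => optimalThreshold_pos i) ?_
  rw [hX.expectedTime_optimal]
  exact ENNReal.ofReal_lt_top

lemma beta_eq (hX : IsUniformSequence X μ) (n : ℕ) :
    beta hX n = ENNReal.ofReal (optimalTime n) := by
  refine le_antisymm (sInf_le ⟨_, hX.isPolicy_optimal n, hX.expectedTime_optimal n⟩) ?_
  refine le_sInf ?_
  rintro _ ⟨τ, hτ, rfl⟩
  exact IsPolicy.optimalTime_le hτ

lemma isOptimalThreshold_optimal (hX : IsUniformSequence X μ) (n : ℕ) :
    IsOptimalThreshold hX n (optimalThresholds n) :=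
  ⟨fun i => optimalThreshold_mem i, hX.isPolicy_optimal n, by
    rw [hX.expectedTime_optimal, beta_eq]⟩

/-- The potential starts at b_n and ends at the expected completion time, again b_n. Being
nondecreasing it is constant, while a wrong threshold at any stage would force a strict increase. -/
lemma IsOptimalThreshold.eq_optimal {hX : IsUniformSequence X μ} {s : Fin n → ℝ}
    (hs : IsOptimalThreshold hX n s) : s = optimalThresholds n := by
  have htop : ∀ k, ∀ᵐ ω ∂μ, thresholdPolicy X s k ω < ⊤ := fun k =>
    hs.isPolicy.ae_forall_lt_top.mono fun ω h => h k
  have hst := hX.isStoppingTime_thresholdPolicy s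
  have hpos : ∀ i, 0 < s i := by
    intro i
    refine lt_of_le_of_ne (hs.mem_Icc i).1 fun h0 => ?_
    have h1 := htop i.rev.succ
    rw [thresholdPolicy_succ, Fin.rev_rev, ← h0] at h1
    have h2 := hX.ae_nextTime_zero (hst i.rev.castSucc) (htop _)
    have hfalse : ∀ᵐ ω ∂μ, False := by
      filter_upwards [h1, h2] with ω h1 h2 using h2 h1
    simp [IsProbabilityMeasure.ne_zero] at hfalse
  have hidx : ∀ k : Fin n, n - (k.castSucc : Fin (n + 1)) = (k.rev : ℕ) + 1 ∧
      n - (k.succ : Fin (n + 1)) = (k.rev : ℕ) := by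
    intro k
    have := k.isLt
    simp only [Fin.val_castSucc, Fin.val_succ, Fin.val_rev]
    exact ⟨by omega, trivial⟩
  have hmono : Monotone fun k : Fin (n + 1) => potential μ X (n - k) (thresholdPolicy X s k) := by
    refine Fin.monotone_iff_le_succ.2 fun k => ?_
    rw [(hidx k).1, (hidx k).2, thresholdPolicy_succ]
    exact hX.potential_le (hst _) (htop _) (hs.mem_Icc _) (hpos _) _
  have h0 : potential μ X (n - (0 : Fin (n + 1))) (thresholdPolicy X s 0)
      = ENNReal.ofReal (optimalTime n) := potential_zero_eq hX fun _ => rfl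
  have hlast : potential μ X (n - Fin.last n) (thresholdPolicy X s (Fin.last n))
      = ENNReal.ofReal (optimalTime n) := by
    rw [Fin.val_last, Nat.sub_self, potential_last, ← beta_eq hX, ← hs.attains]
    rfl
  have heq : ∀ k : Fin (n + 1), potential μ X (n - k) (thresholdPolicy X s k)
      = ENNReal.ofReal (optimalTime n) := fun k =>
    le_antisymm ((hmono (Fin.le_last k)).trans_eq hlast) (h0.symm.trans_le (hmono (Fin.zero_le k)))
  ext i
  by_contra hne
  have h1 := heq i.rev.castSucc
  have h2 := heq i.rev.succ
  rw [(hidx _).1, Fin.rev_rev] at h1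
  rw [(hidx _).2, thresholdPolicy_succ, Fin.rev_rev] at h2
  have := hX.potential_lt (hst _) (htop i.rev.castSucc) (hs.mem_Icc i) (hpos i) i hne
    (by rw [h1]; exact ENNReal.ofReal_ne_top)
  rw [h1, h2] at this
  exact lt_irrefl _ this

end Policies

/-! ### Growth of the optimal times and of the excess. -/

section Asymptotics

/-- The Padé bound at y = d / b, after clearing denominators, reads 3 d² ≤ 6 b + 4 d. -/
lemma increment_sq_le (n : ℕ) : (optimalTime (n + 1) - optimalTime n) ^ 2
    ≤ 2 * optimalTime n + 4 / 3 * (optimalTime (n + 1) - optimalTime n) := by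
  have h := optimalTime_equation n
  have hlt := optimalTime_lt_succ n
  have hb := optimalTime_nonneg n
  rcases hb.eq_or_lt with hb0 | hb0
  · rw [← hb0] at h ⊢
    nlinarith
  set b := optimalTime n
  obtain ⟨d, hd⟩ : ∃ d, d = optimalTime (n + 1) - b := ⟨_, rfl⟩
  have hd0 : 0 < d := by linarith
  rw [show optimalTime (n + 1) = b + d by linarith] at h ⊢
  have h1 := log_one_add_le_pade (y := d / b) (by positivity)
  rw [show 1 + d / b = (b + d) / b by field_simp] at h1
  have h2 : b * Real.log ((b + d) / b) ≤ d * (6 * b + d) / (6 * b + 4 * d) := by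
    calc _ ≤ b * (d / b * (6 + d / b) / (6 + 4 * (d / b))) := by gcongr
      _ = _ := by field_simp
  have h3 : d - 1 ≤ d * (6 * b + d) / (6 * b + 4 * d) := by linarith
  rw [le_div_iff₀ (by positivity)] at h3
  nlinarith

lemma le_increment_sq (n : ℕ) : 2 * optimalTime n + (optimalTime (n + 1) - optimalTime n)
    ≤ (optimalTime (n + 1) - optimalTime n) ^ 2 := by
  have h := optimalTime_equation n
  have hlt := optimalTime_lt_succ n
  have hb := optimalTime_nonneg n
  rcases hb.eq_or_lt with hb0 | hb0
  · rw [← hb0] at h ⊢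
    nlinarith
  set b := optimalTime n
  obtain ⟨d, hd⟩ : ∃ d, d = optimalTime (n + 1) - b := ⟨_, rfl⟩
  have hd0 : 0 < d := by linarith
  rw [show optimalTime (n + 1) = b + d by linarith] at h ⊢
  have h1 := Real.le_log_one_add_of_nonneg (x := d / b) (by positivity)
  rw [show 1 + d / b = (b + d) / b by field_simp] at h1
  have h2 : 2 * b * d / (d + 2 * b) ≤ b * Real.log ((b + d) / b) := by
    calc _ = b * (2 * (d / b) / (d / b + 2)) := by field_simp
      _ ≤ _ := by gcongr
  have h3 : 2 * b * d / (d + 2 * b) ≤ d - 1 := by linarith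
  rw [div_le_iff₀ (by positivity)] at h3
  nlinarith

/-- Matches the coefficient 4/3 of `increment_sq_le` from the other side, up to the error d² / b;
this fixes the excess to first order. -/
lemma le_increment_sq_sharp (n : ℕ) (hb0 : 0 < optimalTime n) :
    2 * optimalTime n + 4 / 3 * (optimalTime (n + 1) - optimalTime n)
      - (optimalTime (n + 1) - optimalTime n) ^ 2 / optimalTime n
    ≤ (optimalTime (n + 1) - optimalTime n) ^ 2 := by
  have h := optimalTime_equation n
  have hlt := optimalTime_lt_succ n
  set b := optimalTime n
  obtain ⟨y, hy⟩ : ∃ y, y = (optimalTime (n + 1) - b) / b := ⟨_, rfl⟩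
  have hy0 : 0 < y := by
    rw [hy]
    exact div_pos (by linarith) hb0
  have hd : optimalTime (n + 1) = b * (1 + y) := by
    rw [hy]
    field_simp
    ring
  rw [hd, mul_div_cancel_left₀ _ hb0.ne'] at h
  rw [hd]
  have h1 := le_log_one_add_quartic hy0.le
  have h2 : 1 ≤ b * (y ^ 2 * (1 / 2 - y / 3 + y ^ 2 / 4)) := by
    have := mul_le_mul_of_nonneg_left h1 hb0.le
    nlinarith
  -- With z = 2 y / 3 - y² / 2 the factors are 2 (1 + z) and (1 - z) / 2, whose product 1 - z² is at
  -- most 1.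
  have h3 : b * (2 + 4 / 3 * y - y ^ 2) ≤ b ^ 2 * y ^ 2 := by
    rcases le_or_gt (2 + 4 / 3 * y - y ^ 2) 0 with hneg | hpos
    · nlinarith [mul_nonneg hb0.le (neg_nonneg.2 hneg), sq_nonneg (b * y)]
    · calc b * (2 + 4 / 3 * y - y ^ 2) = b * (2 + 4 / 3 * y - y ^ 2) * 1 := by ring
        _ ≤ b * (2 + 4 / 3 * y - y ^ 2) * (b * (y ^ 2 * (1 / 2 - y / 3 + y ^ 2 / 4))) := by
          gcongr
        _ = b ^ 2 * y ^ 2 * (1 - (y * (2 / 3 - y / 2)) ^ 2) := by ring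
        _ ≤ b ^ 2 * y ^ 2 * 1 := by
          gcongr
          linarith [sq_nonneg (y * (2 / 3 - y / 2))]
        _ = _ := by ring
  have h4 : (b * (1 + y) - b) ^ 2 / b = b * y ^ 2 := by
    field_simp
    ring
  rw [h4]
  nlinarith

/-- `le_increment_sq` gives (d - 1/2)² ≥ 2 b + 1/4 ≥ n², so d ≥ n + 1/2, exactly what the step from
n² to (n + 1)² needs. -/
lemma sq_le_optimalTime (n : ℕ) : (n : ℝ) ^ 2 ≤ 2 * optimalTime n := by
  induction n with
  | zero => simp [optimalTime_zero]
  | succ n ih =>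
    have h := le_increment_sq n
    have hlt := optimalTime_lt_succ n
    obtain ⟨d, hd⟩ : ∃ d, d = optimalTime (n + 1) - optimalTime n := ⟨_, rfl⟩
    rw [← hd] at h
    have hd0 : 0 < d := by linarith
    have h1 : (n : ℝ) ≤ d - 1 / 2 := by
      have hd1 : 1 ≤ d := by nlinarith [optimalTime_nonneg n]
      refine abs_le_of_sq_le_sq' ?_ (by linarith) |>.2
      nlinarith
    push_cast
    nlinarith

lemma harmonic_succ_cast (n : ℕ) :
    ((harmonic (n + 1) : ℚ) : ℝ) = (harmonic n : ℝ) + 1 / ((n : ℝ) + 1) := by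
  rw [harmonic_succ]
  push_cast
  rw [one_div]

lemma harmonic_cast_nonneg (n : ℕ) : (0 : ℝ) ≤ (harmonic n : ℝ) := by
  induction n with
  | zero => simp
  | succ n ih =>
    rw [harmonic_succ_cast]
    positivity

lemma harmonic_cast_le (n : ℕ) : (harmonic n : ℝ) ≤ n := by
  induction n with
  | zero => simp
  | succ n ih =>
    rw [harmonic_succ_cast]
    push_cast
    have : 1 / ((n : ℝ) + 1) ≤ 1 := by
      rw [div_le_one (by positivity)]
      linarith [(n.cast_nonneg : (0 : ℝ) ≤ n)]
    linarith

/-- With u = n + H_n, `increment_sq_le` gives d ≤ u + 4/3, so twice the next time is at most u² + 2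
u + 8/3. The new harmonic term adds at least 2 to (u + 1)² and absorbs the constant. -/
lemma optimalTime_le_sq (n : ℕ) : 2 * optimalTime n ≤ ((n : ℝ) + harmonic n) ^ 2 := by
  induction n with
  | zero => simp [optimalTime_zero]
  | succ n ih =>
    have h := increment_sq_le n
    obtain ⟨d, hd⟩ : ∃ d, d = optimalTime (n + 1) - optimalTime n := ⟨_, rfl⟩
    rw [← hd] at h
    rw [harmonic_succ_cast]
    obtain ⟨u, hu⟩ : ∃ u, u = (n : ℝ) + harmonic n := ⟨_, rfl⟩
    have hn : (0 : ℝ) ≤ n := n.cast_nonneg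
    have hun : (n : ℝ) ≤ u := by linarith [harmonic_cast_nonneg n]
    rw [← hu] at ih
    have h1 : d - 2 / 3 ≤ u + 2 / 3 := by
      refine abs_le_of_sq_le_sq' ?_ (by linarith) |>.2
      nlinarith
    have h2 : 1 ≤ (u + 1) * (1 / ((n : ℝ) + 1)) := by
      rw [mul_one_div, one_le_div (by positivity)]
      linarith
    have h3 : 0 < 1 / ((n : ℝ) + 1) := by positivity
    rw [show ((n + 1 : ℕ) : ℝ) + (harmonic n + 1 / ((n : ℝ) + 1))
      = (u + 1) + 1 / ((n : ℝ) + 1) by rw [hu]; push_cast; ring]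
    nlinarith

lemma increment_le (n : ℕ) :
    n * (optimalTime (n + 1) - optimalTime n) ≤ 4 * optimalTime n := by
  rcases n with _ | n
  · simp [optimalTime_zero]
  have h := increment_sq_le (n + 1)
  have hsq := sq_le_optimalTime (n + 1)
  have hb := optimalTime_succ_pos n
  obtain ⟨m, hm⟩ : ∃ m : ℝ, m = ((n + 1 : ℕ) : ℝ) := ⟨_, rfl⟩
  have hm1 : 1 ≤ m := by
    rw [hm]
    push_cast
    linarith [(n.cast_nonneg : (0 : ℝ) ≤ n)]
  rw [← hm] at hsq ⊢
  obtain ⟨d, hd⟩ : ∃ d, d = optimalTime (n + 1 + 1) - optimalTime (n + 1) := ⟨_, rfl⟩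
  rw [← hd] at h ⊢
  set b := optimalTime (n + 1)
  by_contra! hcon
  have h1 : 2 * m < d := by
    by_contra! h2
    nlinarith
  have h2 : 4 * b * (d - 4 / 3) < m * d * (d - 4 / 3) :=
    mul_lt_mul_of_pos_right hcon (by linarith)
  have h3 : m * d * (d - 4 / 3) ≤ 2 * b * m := by nlinarith
  have h4 : 2 * b * (2 * (d - 4 / 3) - m) < 0 := by linarith
  have h5 : 0 ≤ 2 * (d - 4 / 3) - m := by linarith
  nlinarith [mul_nonneg hb.le h5]

/-- The excess of the accumulated inverse thresholds over the optimal time. -/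
noncomputable def excess (n : ℕ) : ℝ :=
  ∑ i ∈ Finset.range n, 2 / optimalThreshold i - optimalTime n

/-- Since 2 / t = 2 b / d + 2, the increment of the excess is 2 b / d + 2 - d. The last fraction
isolates the error in d² ≈ 2 b + (4/3) d and leaves the drift 2/3. -/
lemma excess_succ (n : ℕ) : excess (n + 1) = excess n + 2 / 3
    + (2 * optimalTime n + 4 / 3 * (optimalTime (n + 1) - optimalTime n)
      - (optimalTime (n + 1) - optimalTime n) ^ 2) / (optimalTime (n + 1) - optimalTime n) := by
  have hd : optimalTime (n + 1) - optimalTime n ≠ 0 := by linarith [optimalTime_lt_succ n]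
  have hb := (optimalTime_succ_pos n).ne'
  have hthr : 2 / optimalThreshold n
      = 2 * optimalTime (n + 1) / (optimalTime (n + 1) - optimalTime n) := by
    rw [optimalThreshold]
    field_simp
  rw [excess, excess, Finset.sum_range_succ, hthr]
  field_simp
  ring

lemma excess_bounds (n : ℕ) :
    2 / 3 * (n : ℝ) ≤ excess n ∧ excess n ≤ 2 / 3 * (n : ℝ) + 8 * harmonic n := by
  induction n with
  | zero => simp [excess, optimalTime_zero]
  | succ n ih =>
    have hd : 0 < optimalTime (n + 1) - optimalTime n := by linarith [optimalTime_lt_succ n]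
    rw [excess_succ, harmonic_succ_cast]
    push_cast
    have h0 : 0 ≤ (2 * optimalTime n + 4 / 3 * (optimalTime (n + 1) - optimalTime n)
        - (optimalTime (n + 1) - optimalTime n) ^ 2) / (optimalTime (n + 1) - optimalTime n) :=
      div_nonneg (by linarith [increment_sq_le n]) hd.le
    have h1 : (2 * optimalTime n + 4 / 3 * (optimalTime (n + 1) - optimalTime n)
        - (optimalTime (n + 1) - optimalTime n) ^ 2) / (optimalTime (n + 1) - optimalTime n)
        ≤ 8 * (1 / ((n : ℝ) + 1)) := by
      rcases n with _ | n
      · norm_num [optimalTime_zero, optimalTime_one]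
      have hb := optimalTime_succ_pos n
      have hsharp := le_increment_sq_sharp (n + 1) hb
      have hinc := increment_le (n + 1)
      set d := optimalTime (n + 1 + 1) - optimalTime (n + 1)
      set b := optimalTime (n + 1)
      have hn : (0 : ℝ) ≤ n := n.cast_nonneg
      push_cast at hinc ⊢
      -- The error is at most d / b, and `increment_le` bounds this by 4 / (n + 1) ≤ 8 / (n + 2).
      calc _ ≤ d ^ 2 / b / d := by
            gcongr
            linarith
        _ = d / b := by field_simp
        _ ≤ _ := by
          rw [mul_one_div, div_le_div_iff₀ hb (by positivity)]
          nlinarith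
    constructor <;> linarith [ih.1, ih.2]

lemma variance_bound {n : ℕ} (hn : 3 ≤ n) :
    |optimalTime n * (excess n - 1) - (n : ℝ) ^ 3 / 3|
      ≤ 34 * ((n : ℝ) ^ 2 * Real.log n) := by
  have hn' : (3 : ℝ) ≤ n := by exact_mod_cast hn
  have hlog : 1 ≤ Real.log n := by
    rw [Real.le_log_iff_exp_le (by linarith)]
    linarith [Real.exp_one_lt_three]
  obtain ⟨he1, he2⟩ := excess_bounds n
  have hb1 := sq_le_optimalTime n
  have hb2 := optimalTime_le_sq n
  have hH := harmonic_le_one_add_log n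
  have hH0 := harmonic_cast_nonneg n
  have hHn := harmonic_cast_le n
  set H : ℝ := (harmonic n : ℝ)
  set N : ℝ := (n : ℝ)
  set b := optimalTime n
  set D := excess n
  have hNN : 0 ≤ N ^ 2 := sq_nonneg N
  have hlower : N ^ 3 / 3 - N ^ 2 / 2 ≤ b * (D - 1) := by
    calc N ^ 3 / 3 - N ^ 2 / 2 = N ^ 2 / 2 * (2 / 3 * N - 1) := by ring
      _ ≤ b * (D - 1) := by
        apply mul_le_mul <;> linarith
  -- H ≤ N is used twice: to replace (N + H)² by N² + 3 N H, and to turn 12 N H² into 12 N² H, so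
  -- that 17 = 5 + 12. The final 34 comes from H ≤ 1 + log n ≤ 2 log n.
  have hupper : b * (D - 1) ≤ N ^ 3 / 3 + 17 * (N ^ 2 * H) := by
    calc b * (D - 1) ≤ ((N ^ 2 + 3 * (N * H)) / 2) * (2 / 3 * N + 8 * H) := by
          apply mul_le_mul
          · nlinarith
          · linarith
          · linarith
          · positivity
      _ = N ^ 3 / 3 + 5 * (N ^ 2 * H) + 12 * (N * H * H) := by ring
      _ ≤ N ^ 3 / 3 + 5 * (N ^ 2 * H) + 12 * (N * H * N) := by gcongr
      _ = _ := by ring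
  have h1 : N ^ 2 * H ≤ N ^ 2 * (2 * Real.log n) := by
    gcongr
    linarith
  have h2 : N ^ 2 ≤ N ^ 2 * Real.log n := le_mul_of_one_le_right hNN hlog
  rw [abs_le]
  constructor <;> linarith

end Asymptotics

/-! ### The variance of the optimal completion time. -/

section Variance

variable {Ω : Type*} {X : ℕ → Ω → ℝ}

lemma thresholdCompletion_nonneg {n : ℕ} (t : Fin n → ℝ) (ω : Ω) :
    0 ≤ thresholdCompletion X t ω := Nat.cast_nonneg _

variable [mΩ : MeasurableSpace Ω] {μ : Measure Ω}

lemma IsUniformSequence.measurable_thresholdCompletion (hX : IsUniformSequence X μ) {n : ℕ}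
    (t : Fin n → ℝ) : Measurable (thresholdCompletion X t) :=
  stopping_measurable_comp (hX.isStoppingTime_thresholdPolicy t (Fin.last n))
    (fun a : ℕ∞ => (a.toNat : ℝ))

variable [IsProbabilityMeasure μ]

lemma IsUniformSequence.lintegral_optimal_sq (hX : IsUniformSequence X μ) (n : ℕ) :
    ∫⁻ ω, ENNReal.ofReal (thresholdCompletion X (optimalThresholds n) ω ^ 2
      + thresholdCompletion X (optimalThresholds n) ω) ∂μ
      = ENNReal.ofReal (secondMoment n) := by
  have h : ∀ k : Fin (n + 1), ∫⁻ ω, ENNReal.ofReal (quadraticTime (n - k)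
      (thresholdPolicy X (optimalThresholds n) k ω).toNat
      (stoppedValue X (thresholdPolicy X (optimalThresholds n) k) ω)) ∂μ
      = ENNReal.ofReal (secondMoment n) := by
    intro k
    induction k using Fin.induction with
    | zero =>
      have h1 : ∀ ω, stoppedValue X (thresholdPolicy X (optimalThresholds n) 0) ω = 0 := fun ω => by
        rw [stoppedValue_of_eq (m := 0) (show thresholdPolicy X (optimalThresholds n) 0 ω = _ from rfl),
          hX.zero]
      have h2 : ∀ ω, (thresholdPolicy X (optimalThresholds n) 0 ω).toNat = 0 := fun ω => rfl
      simp [h1, h2, quadraticTime]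
    | succ k ih =>
      have h1 : optimalThresholds n k.rev = optimalThreshold (n - (k.succ : Fin (n + 1))) := by
        simp [optimalThresholds, Fin.val_rev]
      have h2 : n - (k.castSucc : Fin (n + 1)) = n - (k.succ : Fin (n + 1)) + 1 := by
        have := k.isLt
        simp only [Fin.val_castSucc, Fin.val_succ]
        omega
      rw [thresholdPolicy_succ, ← ih, h1, h2]
      exact hX.lintegral_quadraticTime (hX.isStoppingTime_thresholdPolicy _ _)
        (hX.ae_thresholdPolicy_lt_top (fun i => optimalThreshold_mem i)
          (fun i => optimalThreshold_pos i) _) _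
  have := h (Fin.last n)
  simpa [quadraticTime, secondMoment, optimalTime_zero, thresholdCompletion, completionTime]
    using this

lemma IsUniformSequence.lintegral_optimal (hX : IsUniformSequence X μ) (n : ℕ) :
    ∫⁻ ω, ENNReal.ofReal (thresholdCompletion X (optimalThresholds n) ω) ∂μ
      = ENNReal.ofReal (optimalTime n) := by
  rw [← hX.expectedTime_optimal n, expectedTime]
  refine lintegral_congr_ae ?_
  filter_upwards [(hX.isPolicy_optimal n).ae_forall_lt_top] with ω hω
  rw [thresholdCompletion, ENNReal.ofReal_natCast]
  exact (toENNReal_eq_toNat (hω _)).symm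

lemma IsUniformSequence.memLp_optimal (hX : IsUniformSequence X μ) (n : ℕ) :
    MemLp (thresholdCompletion X (optimalThresholds n)) 2 μ := by
  have hm := hX.measurable_thresholdCompletion (optimalThresholds n)
  refine (memLp_two_iff_integrable_sq hm.aestronglyMeasurable).2
    ⟨(hm.pow_const 2).aestronglyMeasurable, ?_⟩
  rw [hasFiniteIntegral_iff_ofReal (ae_of_all _ fun ω => sq_nonneg _)]
  refine lt_of_le_of_lt (lintegral_mono fun ω => ENNReal.ofReal_le_ofReal ?_)
    ((hX.lintegral_optimal_sq n).trans_lt ENNReal.ofReal_lt_top)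
  exact le_add_of_nonneg_right (thresholdCompletion_nonneg _ ω)

lemma IsUniformSequence.variance_optimal (hX : IsUniformSequence X μ) (n : ℕ) :
    Var[thresholdCompletion X (optimalThresholds n); μ] = optimalTime n * (excess n - 1) := by
  have hm := hX.measurable_thresholdCompletion (optimalThresholds n)
  have hL := hX.memLp_optimal n
  have hnn := thresholdCompletion_nonneg (X := X) (optimalThresholds n)
  have h1 : ∫ ω, thresholdCompletion X (optimalThresholds n) ω ∂μ = optimalTime n := by
    rw [integral_eq_lintegral_of_nonneg_ae (ae_of_all _ hnn) hm.aestronglyMeasurable,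
      hX.lintegral_optimal, ENNReal.toReal_ofReal (optimalTime_nonneg n)]
  have h2 : ∫ ω, (thresholdCompletion X (optimalThresholds n) ω ^ 2
      + thresholdCompletion X (optimalThresholds n) ω) ∂μ = secondMoment n := by
    rw [integral_eq_lintegral_of_nonneg_ae
      (ae_of_all _ fun ω => add_nonneg (sq_nonneg _) (hnn ω))
      ((hm.pow_const 2).add hm).aestronglyMeasurable,
      hX.lintegral_optimal_sq, ENNReal.toReal_ofReal (secondMoment_nonneg n)]
  rw [integral_add hL.integrable_sq (hL.integrable one_le_two), h1] at h2
  rw [variance_eq_sub hL]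
  simp only [Pi.pow_apply]
  rw [h1, eq_sub_of_add_eq h2, secondMoment, excess]
  ring

end Variance

end MonotoneSelection

theorem theorem2 {Ω : Type*} [MeasurableSpace Ω] (μ : Measure Ω) [IsProbabilityMeasure μ]
    (X : ℕ → Ω → ℝ) (hX : MonotoneSelection.IsUniformSequence X μ) :
    (∀ n : ℕ, IsLeast
      (MonotoneSelection.expectedTime μ '' {τ | MonotoneSelection.IsPolicy hX n τ})
      (MonotoneSelection.beta hX n)) ∧
    ∃ t : (n : ℕ) → Fin n → ℝ,
      (∀ n : ℕ, MonotoneSelection.IsOptimalThreshold hX n (t n) ∧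
        ∀ s : Fin n → ℝ, MonotoneSelection.IsOptimalThreshold hX n s → s = t n) ∧
      (∀ n : ℕ, MemLp (MonotoneSelection.thresholdCompletion X (t n)) 2 μ) ∧
      ∀ α : ℝ, 2 < α →
        (fun n : ℕ => Var[MonotoneSelection.thresholdCompletion X (t n); μ] - (n : ℝ) ^ 3 / 3)
          =O[atTop] fun n : ℕ => (n : ℝ) ^ 2 * Real.log n ^ α := by
  refine ⟨fun n => ⟨⟨_, hX.isPolicy_optimal n,
      (MonotoneSelection.isOptimalThreshold_optimal hX n).attains⟩, fun _ h => sInf_le h⟩,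
    MonotoneSelection.optimalThresholds,
    fun n => ⟨MonotoneSelection.isOptimalThreshold_optimal hX n, fun s hs => hs.eq_optimal⟩,
    hX.memLp_optimal, fun α hα => ?_⟩
  refine IsBigO.of_bound 34 ?_
  filter_upwards [eventually_ge_atTop 3] with n hn
  have hn' : (3 : ℝ) ≤ n := by exact_mod_cast hn
  have hlog : 1 ≤ Real.log n := by
    rw [Real.le_log_iff_exp_le (by linarith)]
    linarith [Real.exp_one_lt_three]
  -- The bound already holds with the first power of log n; since log n ≥ 1, the larger exponent
  -- only weakens it.
  have hpow : Real.log n ≤ Real.log n ^ α := by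
    calc Real.log n = Real.log n ^ (1 : ℝ) := (Real.rpow_one _).symm
      _ ≤ _ := Real.rpow_le_rpow_of_exponent_le hlog (by linarith)
  have h0 : 0 ≤ (n : ℝ) ^ 2 * Real.log n ^ α := by positivity
  rw [hX.variance_optimal, Real.norm_eq_abs, Real.norm_eq_abs, abs_of_nonneg h0]
  refine (MonotoneSelection.variance_bound hn).trans ?_
  gcongr
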